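/- **Conventions.** Rings are commutative with $1$. A valuation $v : R \to \Gamma_0 = \Gamma \cup \{0\}$ ($\Gamma$ a totally ordered commutative group) satisfies $v(0)=0$, $v(1)=1$, $v(xy)=v(x)v(y)$, $v(x+y)\le\max(v(x),v(y))$; its value group is the subgroup of $\Gamma$ generated by its nonzero values. Two valuations are equivalent if they induce the same preorder $v(a)\le v(b)$ on $R$. If $R$ is a topological ring, $v$ is continuous if $\{a : v(a)<\gamma\}$ is open for every $\gamma$ in the value group of $v$. A subset $S$ of a topological ring is bounded if for each neighbourhood $U$ of $0$ there is a neighbourhood $V$ of $0$ with $V\cdot S\subseteq U$, and power-bounded if the set of all finite products of elements of $S$ is bounded; an element $a$ is power-bounded if $\{a\}$ is. A topological ring is non-Archimedean if $0$ has a basis of neighbourhoods consisting of additive subgroups. A Huber ring is a topological ring $A$ with an open subring $A_0$ whose topology is $I$-adic for a finitely generated ideal $I$ of $A_0$; a Huber pair $(A,A^+)$ is a Huber ring $A$ with an open subring $A^+$ that is integrally closed in $A$ and consists of power-bounded elements. $X=\operatorname{Spa}(A,A^+)$ is the set of equivalence classes of continuous valuations $v$ on $A$ with $v(a)\le 1$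 for all $a\in A^+$. For $s\in A$ and a finite $T\subseteq A$ such that the ideal $T\cdot A$ is open, put $R(T/s)=\{v\in X : v(s)\neq 0 \text{ and } v(t)\le v(s)\ \forall t\in T\}$; $X$ carries the topology generated by these rational subsets. For a valuation $v$ on $A$, $K_v$ is the fraction field of $A/\{a : v(a)=0\}$, with the valuation extending $v$ and the topology in which the sets $\{y : v(y)<\gamma\}$, $\gamma$ in the value group, form a basis of neighbourhoods of $0$; $\hat v$ is the extension of $v$ to the completion $\widehat{K_v}$. **Theorem.** Let $(A,A^+)$ be a Huber pair and $X=\operatorname{Spa}(A,A^+)$. 1. The rational subsets $R(T/s)$ form a basis of the topology of $X$. 2. For each $(T,s)$ as above there is a topology on $A[1/s]$ making it a non-Archimedean topological ring, denoted $A(T/s)$, such that the localisation map $\varphi: A\to A(T/s)$ is continuous, $\varphi(s)$ is invertible and $\{\varphi(t)\varphi(s)^{-1} : t\in T\}$ is power-bounded, and which is universal for this: if $B$ is a non-Archimedean topological ring and $f:A\to B$ is a continuous ring homomorphism such that $f(s)$ is invertible and $\{f(t)f(s)^{-1}: t\in T\}$ is power-bounded, then there is a unique continuous ring homomorphism $g:A(T/s)\to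 B$ with $g\circ\varphi=f$. 3. Let $A\langle T/s\rangle$ be the separated completion of $A(T/s)$. Whenever $R(T'/s')\subseteq R(T/s)$ there is a unique continuous homomorphism of rings under $A$, $A\langle T/s\rangle\to A\langle T'/s'\rangle$. Put $\mathcal O(U)=\varprojlim_{R(T/s)\subseteq U}A\langle T/s\rangle$, the limit along these maps, with the limit topology and the obvious restriction maps. Then $\mathcal O$ is a presheaf of complete separated topological rings on $X$; for every $(T,s)$ the projection $\mathcal O(R(T/s))\to A\langle T/s\rangle$ is an isomorphism of topological rings; and these isomorphisms identify the restriction maps $\mathcal O(R(T/s))\to\mathcal O(R(T'/s'))$ with the maps $A\langle T/s\rangle\to A\langle T'/s'\rangle$. 4. For every $x\in X$ there is an equivalence class $v_x$ of valuations on the stalk $\mathcal O_{X,x}$ (the colimit of the rings $\mathcal O(U)$ over open $U\ni x$) such that, for every valuation $v$ representing $x$, there is a ring homomorphism $h:\mathcal O_{X,x}\to\widehat{K_v}$ for which the composites $\mathcal O(U)\to\mathcal O_{X,x}\to\widehat{K_v}$ ($x\in U$ open) are continuous and restrict along $A\to\mathcal O(U)$ to the canonical map $A\to\widehat{K_v}$,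 such that $\hat v\circ h$ represents $v_x$, and every valuation $r$ representing $v_x$ factors as $r=r'\circ h$ with $r'$ a valuation on $\widehat{K_v}$ equivalent to $\hat v$. -/

import Mathlib

open Topology TopologicalSpace CategoryTheory Opposite

universe u v w z

noncomputable section

namespace AdicSpectrum

/-! ### Huber rings and Huber pairs -/

section Huber

variable {R : Type u} [CommRing R] [TopologicalSpace R]

/-- A subset `S` of a topological ring is bounded if for every neighbourhood `U` of `0` there is a
neighbourhood `V` of `0` with `V · S ⊆ U`. -/
def IsBoundedSet (S : Set R) : Prop :=
  ∀ U ∈ 𝓝 (0 : R), ∃ V ∈ 𝓝 (0 : R), ∀ x ∈ V, ∀ y ∈ S, x * y ∈ U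

/-- A subset `S` of a topological ring is power-bounded if the set of all finite products of
elements of `S` is bounded. -/
def IsPowerBoundedSet (S : Set R) : Prop :=
  IsBoundedSet (Submonoid.closure S : Set R)

variable (R) in
/-- A Huber ring: there are an open subring `R₀` and a finitely generated ideal `I` of `R₀` such
that the subspace topology of `R₀` is the `I`-adic topology. -/
def IsHuberRing : Prop :=
  IsTopologicalRing R ∧ ∃ R₀ : Subring R, IsOpen (R₀ : Set R) ∧
    ∃ I : Ideal R₀, I.FG ∧ IsAdic I

/-- `(R, R⁺)` is a Huber pair: `R` is a Huber ring, and `R⁺` is an open subring of `R` that is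
integrally closed in `R` and consists of power-bounded elements. -/
structure IsHuberPair (Rplus : Subring R) : Prop where
  isHuberRing : IsHuberRing R
  isOpen : IsOpen (Rplus : Set R)
  isIntegrallyClosedIn : IsIntegrallyClosedIn Rplus R
  isPowerBounded : ∀ a ∈ Rplus, IsPowerBoundedSet ({a} : Set R)

end Huber

/-! ### The valuation spectrum and the adic spectrum -/

/-- The valuation spectrum of a ring. An equivalence class of valuations is recorded as the
preorder `a ≤ᵥ b ↔ v a ≤ v b` that it induces on the ring. -/
abbrev Spv (R : Type u) [CommRing R] : Type u := ValuativeRel R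

/-- The valuation `v` is a representative of the equivalence class `x`. -/
def Represents {R : Type u} [CommRing R] {Γ₀ : Type v} [LinearOrderedCommGroupWithZero Γ₀]
    (v : Valuation R Γ₀) (x : Spv R) : Prop :=
  ∀ a b : R, x.vle a b ↔ v a ≤ v b

/-- A class of valuations is continuous if its canonical representative, the one whose values
generate the whole value group, has open balls `{a | v a < γ}`. -/
def IsContinuousVal {R : Type u} [CommRing R] [TopologicalSpace R] (x : Spv R) : Prop :=
  letI : ValuativeRel R := x
  ∀ γ : ValuativeRel.ValueGroupWithZero R, IsOpen {a : R | ValuativeRel.valuation R a < γ}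

variable {A : Type u} [CommRing A] [TopologicalSpace A]

/-- The adic spectrum `Spa(A, A⁺)`: the continuous `v` with `v a ≤ 1` for all `a ∈ A⁺`. -/
def Spa (Aplus : Subring A) : Type u :=
  {x : Spv A // IsContinuousVal x ∧ ∀ a ∈ Aplus, x.vle a 1}

variable (A) in
/-- The data defining a rational subset: `s ∈ A` and a finite `T ⊆ A` such that `T · A`, the
additive subgroup generated by all products `t * a`, is open. -/
structure RationalDatum where
  s : A
  T : Finset A
  isOpen_span : IsOpen (Ideal.span (T : Set A) : Set A)

/-- The rational subset `R(T/s) = {v | v s ≠ 0 and v t ≤ v s for all t ∈ T}` of `Spa(A, A⁺)`. -/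
def rationalSubset (Aplus : Subring A) (D : RationalDatum A) : Set (Spa Aplus) :=
  {x | ¬ x.1.vle D.s 0 ∧ ∀ t ∈ D.T, x.1.vle t D.s}

/-- The topology on `Spa(A, A⁺)` is generated by the rational subsets. -/
instance (Aplus : Subring A) : TopologicalSpace (Spa Aplus) :=
  generateFrom (Set.range (rationalSubset Aplus))

/-- The rational subset `R(T/s)` as an open subset. -/
def rationalOpen (Aplus : Subring A) (D : RationalDatum A) : Opens (Spa Aplus) :=
  ⟨rationalSubset Aplus D, isOpen_generateFrom_of_mem ⟨D, rfl⟩⟩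

/-! ### The topological localisation `A(T/s)` and its completion -/

/-- The underlying ring `A[1/s]` of `A(T/s)`. -/
def RatLoc (D : RationalDatum A) : Type u := Localization.Away D.s

namespace RatLoc

variable (D : RationalDatum A)

instance : CommRing (RatLoc D) := inferInstanceAs (CommRing (Localization.Away D.s))

instance : Algebra A (RatLoc D) := inferInstanceAs (Algebra A (Localization.Away D.s))

instance : IsLocalization.Away D.s (RatLoc D) :=
  inferInstanceAs (IsLocalization.Away D.s (Localization.Away D.s))

/-- The set `{t/s | t ∈ T}` in `A[1/s]`. -/
def fractions : Set (RatLoc D) :=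
  (fun t : A => algebraMap A (RatLoc D) t * IsLocalization.Away.invSelf D.s) '' (D.T : Set A)

/-- The topologies that make `A[1/s]` a non-Archimedean topological ring for which `A → A[1/s]` is
continuous and `{t/s | t ∈ T}` is power-bounded. -/
def IsAdmissible (τ : TopologicalSpace (RatLoc D)) : Prop :=
  @NonarchimedeanRing (RatLoc D) _ τ ∧
    @Continuous A (RatLoc D) _ τ (algebraMap A (RatLoc D)) ∧
    @IsPowerBoundedSet (RatLoc D) _ τ (fractions D)

/-- The topology of `A(T/s)`: the finest admissible topology on `A[1/s]`. (In the order of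
topologies used here, finer topologies are smaller.) -/
@[reducible]
def topology : TopologicalSpace (RatLoc D) :=
  sInf {τ | IsAdmissible D τ}

lemma isTopologicalRing_topology : @IsTopologicalRing (RatLoc D) (topology D) _ := by
  let := topology D
  have h : ∀ τ ∈ {τ | IsAdmissible D τ}, @IsTopologicalRing (RatLoc D) τ _ :=
    fun τ hτ => @NonarchimedeanRing.toIsTopologicalRing _ _ τ hτ.1
  have h1 : @ContinuousAdd (RatLoc D) (topology D) _ :=
    continuousAdd_sInf fun τ hτ =>
      @IsTopologicalSemiring.toContinuousAdd _ τ _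
        (@IsTopologicalRing.toIsTopologicalSemiring _ τ _ (h τ hτ))
  have h2 : @ContinuousMul (RatLoc D) (topology D) _ :=
    continuousMul_sInf fun τ hτ =>
      @IsTopologicalSemiring.toContinuousMul _ τ _
        (@IsTopologicalRing.toIsTopologicalSemiring _ τ _ (h τ hτ))
  have h3 : @ContinuousNeg (RatLoc D) (topology D) _ :=
    continuousNeg_sInf fun τ hτ => @IsTopologicalRing.toContinuousNeg _ τ _ (h τ hτ)
  exact { }

/-- The uniform structure of the additive topological group `A(T/s)`; the topology of this uniform
structure is `RatLoc.topology D`. -/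
instance : UniformSpace (RatLoc D) :=
  letI := topology D
  haveI := isTopologicalRing_topology D
  IsTopologicalAddGroup.rightUniformSpace (RatLoc D)

instance : IsTopologicalRing (RatLoc D) := isTopologicalRing_topology D

instance : IsUniformAddGroup (RatLoc D) :=
  letI := topology D
  haveI := isTopologicalRing_topology D
  isUniformAddGroup_of_addCommGroup

end RatLoc

/-- `A⟨T/s⟩`, the separated completion of `A(T/s)`. -/
abbrev RatCompl (D : RationalDatum A) : Type u := UniformSpace.Completion (RatLoc D)

/-- The canonical ring homomorphism `A → A(T/s) → A⟨T/s⟩`. -/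
def toRatCompl (D : RationalDatum A) : A →+* RatCompl D :=
  UniformSpace.Completion.coeRingHom.comp (algebraMap A (RatLoc D))

/-- `ρ : A⟨T/s⟩ → A⟨T'/s'⟩` is a continuous homomorphism of rings under `A`. -/
def IsCanonicalMap {D D' : RationalDatum A} (ρ : RatCompl D →+* RatCompl D') : Prop :=
  Continuous ρ ∧ ρ.comp (toRatCompl D) = toRatCompl D'

/-! ### The structure presheaf -/

/-- The sections over an open `U`: the limit of the rings `A⟨T/s⟩` over the rational subsets
`R(T/s) ⊆ U`, that is, the subring of the product of these rings consisting of the families that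
are compatible with the canonical maps `A⟨T/s⟩ → A⟨T'/s'⟩` for `R(T'/s') ⊆ R(T/s)`. It carries
the subspace topology of the product topology. -/
def sections (Aplus : Subring A) (U : Opens (Spa Aplus)) :
    Subring (∀ D : {D : RationalDatum A // rationalOpen Aplus D ≤ U}, RatCompl D.1) where
  carrier := {f | ∀ D D' : {D : RationalDatum A // rationalOpen Aplus D ≤ U},
    rationalOpen Aplus D'.1 ≤ rationalOpen Aplus D.1 →
      ∀ ρ : RatCompl D.1 →+* RatCompl D'.1, IsCanonicalMap ρ → ρ (f D) = f D'}
  mul_mem' hf hg D D' h ρ hρ := by simp [hf D D' h ρ hρ, hg D D' h ρ hρ]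
  one_mem' D D' h ρ hρ := by simp
  add_mem' hf hg D D' h ρ hρ := by simp [hf D D' h ρ hρ, hg D D' h ρ hρ]
  zero_mem' D D' h ρ hρ := by simp
  neg_mem' hf D D' h ρ hρ := by simp [hf D D' h ρ hρ]

/-- The restriction map between rings of sections: forget the components outside the smaller open
set. -/
def restrict (Aplus : Subring A) {U V : Opens (Spa Aplus)} (h : V ≤ U) :
    sections Aplus U →+* sections Aplus V where
  toFun f := ⟨fun D => f.1 ⟨D.1, D.2.trans h⟩,
    fun D D' hD ρ hρ => f.2 ⟨D.1, D.2.trans h⟩ ⟨D'.1, D'.2.trans h⟩ hD ρ hρ⟩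
  map_one' := rfl
  map_mul' _ _ := rfl
  map_zero' := rfl
  map_add' _ _ := rfl

lemma continuous_restrict (Aplus : Subring A) {U V : Opens (Spa Aplus)} (h : V ≤ U) :
    Continuous (restrict Aplus h) :=
  Continuous.subtype_mk
    (continuous_pi fun D => (continuous_apply (⟨D.1, D.2.trans h⟩ :
      {D : RationalDatum A // rationalOpen Aplus D ≤ U})).comp continuous_subtype_val) _

/-- The structure presheaf `𝒪` on `Spa(A, A⁺)`, a presheaf of topological commutative rings. -/
def structurePresheaf (Aplus : Subring A) :
    TopCat.Presheaf TopCommRingCat.{u} (TopCat.of (Spa Aplus)) where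
  obj U := TopCommRingCat.of (sections Aplus U.unop)
  map i := ⟨restrict Aplus i.unop.le, continuous_restrict Aplus i.unop.le⟩
  map_id _ := rfl
  map_comp _ _ := rfl

/-- The canonical ring homomorphism `A → 𝒪(U)`. -/
def toSections (Aplus : Subring A) (U : Opens (Spa Aplus)) : A →+* sections Aplus U where
  toFun a := ⟨fun D => toRatCompl D.1 a, fun _ _ _ _ hρ => DFunLike.congr_fun hρ.2 a⟩
  map_one' := by ext; simp
  map_mul' _ _ := by ext; simp
  map_zero' := by ext; simp
  map_add' _ _ := by ext; simp

/-- The canonical ring homomorphism `𝒪(R(T/s)) → A⟨T/s⟩`. -/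
def toValue (Aplus : Subring A) (D : RationalDatum A) :
    sections Aplus (rationalOpen Aplus D) →+* RatCompl D where
  toFun f := f.1 ⟨D, le_rfl⟩
  map_one' := rfl
  map_mul' _ _ := rfl
  map_zero' := rfl
  map_add' _ _ := rfl

/-- The presheaf of rings underlying the structure presheaf. -/
abbrev ringPresheaf (Aplus : Subring A) :
    TopCat.Presheaf CommRingCat.{u} (TopCat.of (Spa Aplus)) :=
  structurePresheaf Aplus ⋙ forget₂ TopCommRingCat CommRingCat

/-- The stalk `𝒪_x`, the colimit of the rings `𝒪(U)` over the open neighbourhoods `U` of `x`. -/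
abbrev Stalk (Aplus : Subring A) (x : Spa Aplus) : Type u :=
  (TopCat.Presheaf.stalk (C := CommRingCat.{u}) (X := TopCat.of (Spa Aplus))
    (ringPresheaf Aplus) x : CommRingCat.{u})

/-- The canonical map `𝒪(U) → 𝒪_x` for `x ∈ U`. -/
def germ (Aplus : Subring A) (U : Opens (Spa Aplus)) (x : Spa Aplus) (hx : x ∈ U) :
    sections Aplus U →+* Stalk Aplus x :=
  (TopCat.Presheaf.germ (X := TopCat.of (Spa Aplus)) (ringPresheaf Aplus) U x hx).hom

/-- A topological commutative ring is complete if every Cauchy filter for the uniform structure of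
its additive group converges. -/
def IsCompleteRing (R : Type u) [CommRing R] [TopologicalSpace R] [IsTopologicalRing R] : Prop :=
  @CompleteSpace R (IsTopologicalAddGroup.rightUniformSpace R)

/-! ### The completed residue field of a valuation -/

section ResidueField

variable {R : Type u} [CommRing R] {Γ₀ : Type v} [LinearOrderedCommGroupWithZero Γ₀]

/-- The extension of a valuation `v` on `R` to the field `K_v = Frac(R / supp v)`. -/
def fracValuation (v : Valuation R Γ₀) : Valuation (FractionRing (R ⧸ v.supp)) Γ₀ :=
  (v.onQuot le_rfl).extendToLocalization (S := nonZeroDivisors (R ⧸ v.supp))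
    (by
      intro y hy hy'
      have h : y ∈ (v.onQuot le_rfl).supp := hy'
      rw [Valuation.supp_quot_supp] at h
      exact nonZeroDivisors.ne_zero hy h) _

/-- The completion of `K_v` for the topology defined by the extension of `v`; a basis of
neighbourhoods of `0` is given by the sets `{y | v y < γ}` with `γ` in the value group of `v`. -/
abbrev CompletedField (v : Valuation R Γ₀) : Type u := (fracValuation v).Completion

/-- The canonical ring homomorphism from `R` to the completion of `K_v`. -/
def toCompletedField (v : Valuation R Γ₀) : R →+* CompletedField v :=
  (UniformSpace.Completion.coeRingHom (α := WithVal (fracValuation v))).comp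
    ((WithVal.equiv (fracValuation v)).symm.toRingHom.comp
      ((algebraMap (R ⧸ v.supp) (FractionRing (R ⧸ v.supp))).comp (Ideal.Quotient.mk v.supp)))

/-- The extension of `v` to a valuation on the completion of `K_v`. -/
def completedValuation (v : Valuation R Γ₀) : Valuation (CompletedField v) Γ₀ :=
  Valued.extensionValuation (K := WithVal (fracValuation v))

end ResidueField

end AdicSpectrum

end

/-! The topology of `A(T/s)` is the finest admissible one, so its universal property is formal: the
topology pulled back along `A[1/s] → B` is admissible. An explicit description takes more work. If
`P n` are the powers of a finitely generated ideal of definition and `M = ℤ[t/s]`, then the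
subgroups `P n · M` form a basis at `0` (`RatLoc.hasBasis_nhds_zero`). Division by `s` is continuous
for them because openness of `T · A` puts some `P j` inside `T · P i`
(`IsAdicFiltration.exists_le_span_mul`).

The heart is `exists_unit_isPowerBoundedSet`: if `R(T'/s') ⊆ R(T/s)`, then `s` becomes invertible
and the `t/s` become power-bounded in `A⟨T'/s'⟩`. Let `W ⊆ A(T'/s')` be the integral closure of the
subring generated by `A⁺` and the fractions `t'/s'`, and let `J` be the ideal of `W` generated by
generators of an ideal of definition. Continuous valuations bounded by `1` on `W` restrict to points
of `R(T'/s')`. Enough of them exist: Chevalley's extension theorem gives valuations that are `≤ 1`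
on `W` and `< 1` on `J`, and `retract` makes these continuous by sending to `0` whatever lies below
all powers of the largest value on `J`. Hence an element vanishing nowhere is a unit modulo `J`, and
an element that is `≤ 1` everywhere is integral over `W`. So `s c = 1 - j` with `j` topologically
nilpotent, each `t c` is power-bounded, and the geometric series inverts `1 - j` after completion.
The universal property now yields the transition maps, and the limit over the rational subsets of
`R(T/s)` is its value at the largest one.

At a point `x` represented by `v`, the same universal property extends `A → K̂_v` to every `A⟨T/s⟩`
with `x ∈ R(T/s)`, hence to the stalk. The resulting class does not depend on `v`: the conditions
`v̂(y) v(a) < v(b)` are clopen and have the same truth value for two representatives on the dense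
image of `A[1/s]`. Every value of `v̂` is a quotient of values coming from `A`, so a valuation in
the class extends to `K̂_v` by quotients. -/

noncomputable section

namespace AdicSpectrum

/-! ### Constructing and modifying valuations. -/

section Valuations

/-- A proper ideal of a subring `W` of `E` is the centre of a valuation of `E` that is bounded
by `1` on `W`. -/
theorem exists_valuation_of_ideal_ne_top {E : Type u} [CommRing E] (W : Subring E) (I : Ideal W)
    (hI : I ≠ ⊤) :
    ∃ (Γ₀ : Type u) (_ : LinearOrderedCommGroupWithZero Γ₀) (v : Valuation E Γ₀),
      (∀ w ∈ W, v w ≤ 1) ∧ ∀ w ∈ I, v (w : E) < 1 := by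
  obtain ⟨p, hp, hIp⟩ := I.exists_le_maximal hI
  -- Minimal primes of `W` are contracted from `E`. Modulo such a `Q` the ideal `p` stays proper,
  -- because `Q ∩ W ⊆ p`.
  obtain ⟨q, hq, hqp⟩ := Ideal.exists_minimalPrimes_le (bot_le : ⊥ ≤ p)
  obtain ⟨Q, hQ, rfl⟩ := Ideal.exists_comap_eq_of_mem_minimalPrimes_of_injective
    (f := W.subtype) Subtype.val_injective q hq
  let K := FractionRing (E ⧸ Q)
  let φ : E →+* K := (algebraMap (E ⧸ Q) K).comp (Ideal.Quotient.mk Q)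
  have hφ : ∀ e : E, φ e = 0 ↔ e ∈ Q := fun e => by
    simp only [φ, RingHom.comp_apply]
    rw [map_eq_zero_iff _ (IsFractionRing.injective (E ⧸ Q) K), Ideal.Quotient.eq_zero_iff_mem]
  let ψ : W →+* W.map φ := φ.restrict W (W.map φ) fun x hx => ⟨x, hx, rfl⟩
  have hψ : Function.Surjective ψ := by
    rintro ⟨_, x, hx, rfl⟩
    exact ⟨⟨x, hx⟩, rfl⟩
  have hne : p.map ψ ≠ ⊤ := by
    intro h
    obtain ⟨x, hx, hx1⟩ := (Ideal.mem_map_iff_of_surjective ψ hψ).1 (h ▸ Submodule.mem_top :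
      (1 : W.map φ) ∈ p.map ψ)
    have h1 : φ (x - 1 : E) = 0 := by
      have := congrArg Subtype.val hx1
      rw [map_sub, map_one, sub_eq_zero]
      exact this
    have h2 : x - 1 ∈ p := hqp (show ((x - 1 : W) : E) ∈ Q from (hφ _).1 h1)
    exact hp.ne_top ((Ideal.eq_top_iff_one p).2 (by simpa using p.sub_mem hx h2))
  -- Chevalley: a valuation ring of the residue field at `Q` contains the image of `W` and has the
  -- image of `p` among its nonunits.
  obtain ⟨V, hWV, hV⟩ := Ideal.image_subset_nonunits_valuationSubring _ hne
  refine ⟨V.ValueGroup, inferInstance, V.valuation.comap φ, fun w hw => ?_, fun w hw => ?_⟩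
  · exact (V.valuation_le_one_iff _).2 (hWV ⟨w, hw, rfl⟩)
  · exact V.mem_nonunits_iff.1 (hV ⟨ψ w, Ideal.mem_map_of_mem ψ (hIp hw), rfl⟩)

variable {R : Type u} [CommRing R] {Γ₀ : Type v} [LinearOrderedCommGroupWithZero Γ₀]

open scoped Classical in
/-- If all values of `v` are bounded by powers of `γ⁻¹`, sending the elements whose values are
smaller than all powers of `γ` to `0` gives a valuation. -/
def retract (v : Valuation R Γ₀) (γ : Γ₀) (h : ∀ a, ∃ n : ℕ, v a * γ ^ n ≤ 1) :
    Valuation R Γ₀ where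
  toFun a := if ∃ n : ℕ, γ ^ n ≤ v a then v a else 0
  map_zero' := by simp
  map_one' := by rw [if_pos ⟨0, by simp⟩, map_one]
  map_mul' a b := by
    -- A product survives only if both factors do: `v b` is at most some `γ⁻ᵐ`, so `a` cannot be
    -- much smaller than `a * b`.
    have key : ∀ a b : R, (∃ n : ℕ, γ ^ n ≤ v (a * b)) → ∃ n : ℕ, γ ^ n ≤ v a := by
      rintro a b ⟨n, hn⟩
      obtain ⟨m, hm⟩ := h b
      refine ⟨n + m, ?_⟩
      calc γ ^ (n + m) = γ ^ n * γ ^ m := pow_add _ _ _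
        _ ≤ v (a * b) * γ ^ m := by gcongr
        _ = v a * (v b * γ ^ m) := by rw [map_mul, mul_assoc]
        _ ≤ v a * 1 := by gcongr
        _ = v a := mul_one _
    by_cases ha : ∃ n : ℕ, γ ^ n ≤ v a
    · by_cases hb : ∃ n : ℕ, γ ^ n ≤ v b
      · obtain ⟨n, hn⟩ := id ha
        obtain ⟨m, hm⟩ := id hb
        have hab : ∃ n : ℕ, γ ^ n ≤ v (a * b) :=
          ⟨n + m, by rw [pow_add, map_mul]; exact mul_le_mul' hn hm⟩
        rw [if_pos ha, if_pos hb, if_pos hab, map_mul]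
      · rw [if_neg hb, mul_zero, if_neg fun h' => hb (key b a (by rwa [mul_comm]))]
    · rw [if_neg ha, zero_mul, if_neg fun h' => ha (key a b h')]
  map_add_le_max' a b := by
    wlog hab : v b ≤ v a generalizing a b
    · rw [add_comm, max_comm]
      exact this b a (le_of_not_ge hab)
    by_cases hs : ∃ n : ℕ, γ ^ n ≤ v (a + b)
    · have hle : v (a + b) ≤ v a := (v.map_add a b).trans (max_le le_rfl hab)
      obtain ⟨n, hn⟩ := id hs
      rw [if_pos hs, if_pos (⟨n, hn.trans hle⟩ : ∃ n : ℕ, γ ^ n ≤ v a)]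
      exact hle.trans (le_max_left _ _)
    · rw [if_neg hs]
      exact zero_le

theorem retract_apply_of_pow_le {v : Valuation R Γ₀} {γ : Γ₀} {h} {a : R} {n : ℕ}
    (ha : γ ^ n ≤ v a) : retract v γ h a = v a :=
  if_pos ⟨n, ha⟩

theorem retract_le (v : Valuation R Γ₀) (γ : Γ₀) (h) (a : R) : retract v γ h a ≤ v a := by
  classical
  change (if ∃ n : ℕ, γ ^ n ≤ v a then v a else 0) ≤ v a
  split_ifs
  exacts [le_rfl, zero_le]

theorem exists_pow_le_of_retract_ne_zero {v : Valuation R Γ₀} {γ : Γ₀} {h} {a : R}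
    (ha : retract v γ h a ≠ 0) : ∃ n : ℕ, γ ^ n ≤ v a := by
  by_contra hn
  exact ha (if_neg hn)

/-- The equivalence class of a valuation. -/
@[reducible]
def valClass (v : Valuation R Γ₀) : Spv R := ValuativeRel.ofValuation v

theorem represents_valClass (v : Valuation R Γ₀) : Represents v (valClass v) :=
  fun _ _ => Iff.rfl

theorem represents_valuation (x : Spv R) :
    Represents (letI : ValuativeRel R := x; ValuativeRel.valuation R) x :=
  letI : ValuativeRel R := x
  fun a b => Valuation.Compatible.vle_iff_le a b

theorem Represents.eq_zero_iff {v : Valuation R Γ₀} {x : Spv R} (h : Represents v x) (a : R) :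
    x.vle a 0 ↔ v a = 0 := by
  rw [h, map_zero, le_zero_iff]

theorem Represents.isEquiv {Γ₁ : Type w} [LinearOrderedCommGroupWithZero Γ₁] {v : Valuation R Γ₀}
    {v' : Valuation R Γ₁} {x : Spv R} (h : Represents v x) (h' : Represents v' x) :
    v.IsEquiv v' :=
  fun a b => (h a b).symm.trans (h' a b)

/-- Continuity of a class of valuations in terms of an arbitrary representative. -/
theorem isContinuousVal_iff [TopologicalSpace R] {v : Valuation R Γ₀} {x : Spv R}
    (h : Represents v x) :
    IsContinuousVal x ↔ ∀ b s : R, v s ≠ 0 → IsOpen {a : R | v a * v s < v b} := by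
  let : ValuativeRel R := x
  have key : ∀ (b : R) (s : ValuativeRel.posSubmonoid R),
      {a : R | ValuativeRel.valuation R a < ValuativeRel.ValueGroupWithZero.mk b s} =
        {a : R | v a * v s < v b} := by
    intro b s
    ext a
    change ValuativeRel.ValueGroupWithZero.mk a 1 < _ ↔ _
    rw [ValuativeRel.ValueGroupWithZero.mk_lt_mk]
    simp only [Submonoid.coe_one, mul_one, Set.mem_ofPred_eq]
    rw [← map_mul, ← not_le, ← h, ← ValuativeRel.not_vle]
  constructor
  · intro hx b s hs
    have hs' : ¬ x.vle s 0 := fun h' => hs ((h.eq_zero_iff s).1 h')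
    rw [← key b ⟨s, hs'⟩]
    exact hx _
  · intro H γ
    induction γ using ValuativeRel.ValueGroupWithZero.ind with
    | mk b s =>
      rw [key]
      exact H b s fun h' => s.2 ((h.eq_zero_iff _).2 h')

theorem IsContinuousVal.isOpen_lt [TopologicalSpace R] {v : Valuation R Γ₀} {x : Spv R}
    (hx : IsContinuousVal x) (h : Represents v x) {b s : R} (hs : v s ≠ 0) :
    IsOpen {a : R | v a * v s < v b} :=
  (isContinuousVal_iff h).1 hx b s hs

/-- The pullback of a class of valuations along a ring homomorphism. -/
@[reducible]
def comapSpv {S : Type w} [CommRing S] (f : S →+* R) (x : Spv R) : Spv S :=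
  valClass (Valuation.comap f (letI : ValuativeRel R := x; ValuativeRel.valuation R))

theorem comapSpv_vle {S : Type w} [CommRing S] (f : S →+* R) (x : Spv R) (a b : S) :
    (comapSpv f x).vle a b ↔ x.vle (f a) (f b) :=
  (represents_valuation x (f a) (f b)).symm

/-- The elements of `W` of value at most `γ`. -/
def leIdeal (v : Valuation R Γ₀) (W : Subring R)
    (hW : ∀ w ∈ W, v w ≤ 1) (γ : Γ₀) : Ideal W where
  carrier := {w | v (w : R) ≤ γ}
  zero_mem' := by simp
  add_mem' ha hb := (v.map_add _ _).trans (max_le ha hb)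
  smul_mem' c x hx := by
    have : v (c : R) * v (x : R) ≤ 1 * γ := mul_le_mul' (hW _ c.2) hx
    simpa using this

/-- The maximum over finitely many generators bounds the whole ideal. This value is the `γ` used for
`retract`. Inserting `0` covers an empty set of generators. -/
theorem exists_forall_le_of_fg
    {v : Valuation R Γ₀} {W : Subring R} {J : Ideal W} (hJ : J.FG) (hW : ∀ w ∈ W, v w ≤ 1) :
    ∃ j ∈ J, ∀ i ∈ J, v (i : R) ≤ v (j : R) := by
  classical
  obtain ⟨F, rfl⟩ := hJ
  obtain ⟨j, hj, hmax⟩ := (insert 0 F).exists_max_image (fun i : W => v (i : R)) ⟨0, by simp⟩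
  refine ⟨j, ?_, fun i hi => ?_⟩
  · rcases Finset.mem_insert.1 hj with rfl | hj
    exacts [zero_mem _, Ideal.subset_span hj]
  · have : Ideal.span (F : Set W) ≤ leIdeal v W hW (v (j : R)) :=
      Ideal.span_le.2 fun i hi => hmax i (Finset.mem_insert_of_mem hi)
    exact this hi

end Valuations

/-! ### Continuous valuations detect units modulo `J` and integrality over `W`. -/

section Continuity

variable {C : Type u} [CommRing C] [TopologicalSpace C]

/-- `W` is an open subring of `C` whose finitely generated ideal `J` has open powers and is
absorbed by every element of `C`. -/
structure IsDefiningPair (W : Subring C) (J : Ideal W) : Prop where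
  fg : J.FG
  mem_nhds : ∀ n : ℕ, (Subtype.val '' ((J ^ n : Ideal W) : Set W) : Set C) ∈ 𝓝 0
  absorbs : ∀ c : C, ∀ j ∈ J, ∃ n : ℕ, c * (j : C) ^ n ∈ W

/-- A valuation that is bounded by `1` on `W` and by elements smaller than `1` on `J` can be made
continuous without changing its values that are at least `1`. -/
theorem IsDefiningPair.exists_isContinuousVal [IsTopologicalRing C] {W : Subring C} {J : Ideal W}
    (h : IsDefiningPair W J) {Γ₀ : Type v} [LinearOrderedCommGroupWithZero Γ₀]
    (v : Valuation C Γ₀) (hW : ∀ w ∈ W, v w ≤ 1) (hJ : ∀ j ∈ J, v (j : C) < 1) :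
    ∃ v' : Valuation C Γ₀, IsContinuousVal (valClass v') ∧ (∀ a, v' a ≤ v a) ∧
      ∀ a, 1 ≤ v a → v' a = v a := by
  obtain ⟨j, hj, hmax⟩ := exists_forall_le_of_fg h.fg hW
  have hbd : ∀ a, ∃ n : ℕ, v a * v (j : C) ^ n ≤ 1 := fun a => by
    obtain ⟨n, hn⟩ := h.absorbs a j hj
    exact ⟨n, by simpa using hW _ hn⟩
  have hpow : ∀ n : ℕ, ∀ i ∈ J ^ n, v (i : C) ≤ v (j : C) ^ n := by
    intro n
    induction n with
    | zero => intro i _; simpa using hW _ i.2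
    | succ n ih =>
      have : J ^ (n + 1) ≤ leIdeal v W hW (v (j : C) ^ (n + 1)) := by
        rw [pow_succ, Ideal.mul_le]
        intro r hr s hs
        change v ((r : C) * (s : C)) ≤ _
        rw [map_mul, pow_succ]
        exact mul_le_mul' (ih r hr) (hmax s hs)
      exact fun i hi => this hi
  refine ⟨retract v (v (j : C)) hbd, ?_, retract_le _ _ _, fun a ha =>
    retract_apply_of_pow_le (n := 0) (by simpa using ha)⟩
  set v' := retract v (v (j : C)) hbd with hv'
  rw [isContinuousVal_iff (represents_valClass v')]
  intro b s hs
  by_cases hb : v' b = 0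
  · simp [hb]
  let G : AddSubgroup C :=
    { carrier := {a | v' a * v' s < v' b}
      zero_mem' := by simpa [zero_lt_iff] using hb
      add_mem' := by
        intro x y hx hy
        refine lt_of_le_of_lt (mul_le_mul_left (v'.map_add x y) _) ?_
        rcases max_cases (v' x) (v' y) with ⟨h, _⟩ | ⟨h, _⟩ <;> rw [h] <;> assumption
      neg_mem' := by
        intro x hx
        simpa [Valuation.map_neg] using hx }
  refine G.isOpen_of_mem_nhds (g := 0) ?_
  obtain ⟨n, hn⟩ := exists_pow_le_of_retract_ne_zero hb
  obtain ⟨m, hm⟩ := hbd s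
  have hb' : v' b = v b := retract_apply_of_pow_le hn
  -- The exponent `m` absorbs `v s`, the exponent `n` reaches `v b`, and the extra `1` makes the
  -- inequality strict.
  refine Filter.mem_of_superset (h.mem_nhds (n + 1 + m)) ?_
  rintro _ ⟨i, hi, rfl⟩
  change v' (i : C) * v' s < v' b
  have h1 : v' (i : C) * v' s ≤ v (j : C) ^ (n + 1) := calc
    v' (i : C) * v' s ≤ v (i : C) * v s := mul_le_mul' (retract_le _ _ _ _) (retract_le _ _ _ _)
    _ ≤ v (j : C) ^ (n + 1 + m) * v s := by gcongr; exact hpow _ i hi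
    _ = v (j : C) ^ (n + 1) * (v s * v (j : C) ^ m) := by rw [pow_add]; ac_rfl
    _ ≤ v (j : C) ^ (n + 1) * 1 := by gcongr
    _ = _ := mul_one _
  refine h1.trans_lt ?_
  -- If `J` has only the value `0`, multiplying by `v j < 1` no longer decreases strictly, but the
  -- left side is already `0`.
  rcases eq_or_ne (v (j : C)) 0 with h0 | h0
  · rw [h0, zero_pow (by simp)]
    exact zero_lt_iff.2 hb
  · rw [hb']
    refine lt_of_lt_of_le ?_ hn
    rw [pow_succ]
    exact mul_lt_of_lt_one_right (zero_lt_iff.2 (pow_ne_zero _ h0)) (hJ j hj)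

/-- An element with no zero in the spectrum is a unit modulo `J`. -/
theorem IsDefiningPair.exists_mul_add_eq_one [IsTopologicalRing C] {W : Subring C} {J : Ideal W}
    (h : IsDefiningPair W J) {s : C}
    (hs : ∀ x : Spv C, IsContinuousVal x → (∀ w ∈ W, x.vle w 1) → ¬ x.vle s 0) :
    ∃ c : C, ∃ j ∈ J, s * c + (j : C) = 1 := by
  by_contra hcon
  -- If `1 ∉ sC + J`, then `J` stays proper in the image of `W` in `C/(s)`. A valuation centred
  -- there pulls back to one that kills `s`.
  let φ := Ideal.Quotient.mk (Ideal.span {s})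
  let ψ : W →+* W.map φ := φ.restrict W (W.map φ) fun x hx => ⟨x, hx, rfl⟩
  have hψ : Function.Surjective ψ := by
    rintro ⟨_, x, hx, rfl⟩
    exact ⟨⟨x, hx⟩, rfl⟩
  have hne : J.map ψ ≠ ⊤ := by
    intro h
    obtain ⟨j, hj, hj1⟩ := (Ideal.mem_map_iff_of_surjective ψ hψ).1 (h ▸ Submodule.mem_top :
      (1 : W.map φ) ∈ J.map ψ)
    have h1 : φ (1 - j : C) = 0 := by
      have := congrArg Subtype.val hj1
      rw [map_sub, map_one, sub_eq_zero]
      exact this.symm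
    rw [Ideal.Quotient.eq_zero_iff_mem, Ideal.mem_span_singleton] at h1
    obtain ⟨c, hc⟩ := h1
    exact hcon ⟨c, j, hj, by rw [← hc]; ring⟩
  obtain ⟨Γ₀, _, v, hvW, hvJ⟩ := exists_valuation_of_ideal_ne_top _ _ hne
  obtain ⟨v', hv', hle, -⟩ := h.exists_isContinuousVal (v.comap φ)
    (fun w hw => hvW _ ⟨w, hw, rfl⟩) (fun j hj => hvJ _ (Ideal.mem_map_of_mem ψ hj))
  refine hs _ hv' (fun w hw => ?_) ?_
  · change v' w ≤ v' 1
    rw [map_one]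
    exact (hle w).trans (hvW _ ⟨w, hw, rfl⟩)
  · change v' s ≤ v' 0
    refine (hle s).trans ?_
    have : φ s = 0 := Ideal.Quotient.eq_zero_iff_mem.2 (Ideal.mem_span_singleton_self s)
    simp [this]

-- The equation holds in `S` after multiplication by some `f ^ n`, which is multiplication of the
-- monic polynomial by `X ^ n`.
open Polynomial in
theorem isIntegral_of_isIntegral_localization_away {R S : Type*} [CommRing R] [CommRing S]
    [Algebra R S] (f : S)
    (h : IsIntegral R (algebraMap S (Localization.Away f) f)) : IsIntegral R f := by
  obtain ⟨p, hp, hpf⟩ := h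
  rw [IsScalarTower.algebraMap_eq R S (Localization.Away f), ← Polynomial.hom_eval₂] at hpf
  obtain ⟨⟨_, n, rfl⟩, hn⟩ := (IsLocalization.map_eq_zero_iff (Submonoid.powers f)
    (Localization.Away f) _).1 hpf
  refine ⟨X ^ n * p, (monic_X_pow n).mul hp, ?_⟩
  simpa using hn

open Polynomial Algebra in
/-- An element bounded by `1` on the spectrum is integral over `W`. -/
theorem IsDefiningPair.isIntegral [IsTopologicalRing C] {W : Subring C} {J : Ideal W}
    (h : IsDefiningPair W J) {f : C}
    (hf : ∀ x : Spv C, IsContinuousVal x → (∀ w ∈ W, x.vle w 1) → x.vle f 1) :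
    IsIntegral W f := by
  by_contra hcon
  let E := Localization.Away f
  let φ : C →+* E := algebraMap C E
  have hu : IsUnit (φ f) := IsLocalization.Away.algebraMap_isUnit f
  let y : E := IsLocalization.Away.invSelf f
  have hy : φ f * y = 1 := IsLocalization.Away.mul_invSelf f
  let : Invertible y := ⟨φ f, hy, by rw [mul_comm]; exact hy⟩
  let B : Subalgebra W E := Algebra.adjoin W {y}
  let yB : B.toSubring := ⟨y, subset_adjoin rfl⟩
  have hne : Ideal.span {yB} ≠ ⊤ := by
    intro heq
    -- Properness of `⊥` is needed below. If it fails, `C` is the zero ring and `f = 0` is integral.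
    have hbot : (⊥ : Ideal W) ≠ ⊤ := by
      intro hb
      have h10 : (1 : W) = 0 := by
        have : (1 : W) ∈ (⊥ : Ideal W) := hb ▸ Submodule.mem_top
        simpa using this
      have h10' : (1 : C) = 0 := congrArg Subtype.val h10
      exact hcon (by rw [← mul_one f, h10', mul_zero]; exact isIntegral_zero)
    -- If `y = 1/f` is a unit of `W[y]`, clearing powers of `y` in `1 ∈ y W[y]` gives a monic
    -- equation for `f`.
    obtain ⟨p, hp, hpx⟩ := exists_aeval_invOf_eq_zero_of_idealMap_adjoin_sup_span_eq_top y
      (⊥ : Ideal W) hbot (top_unique (heq.ge.trans le_add_self))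
    exact hcon (isIntegral_of_isIntegral_localization_away f
      ⟨p, by simpa [Monic, sub_eq_zero] using hp, hpx⟩)
  obtain ⟨Γ₀, _, v, hvB, hvy⟩ := exists_valuation_of_ideal_ne_top _ _ hne
  have hW : ∀ w ∈ W, v.comap φ w ≤ 1 := fun w hw => hvB _ (B.algebraMap_mem ⟨w, hw⟩)
  have hy1 : v y < 1 := hvy yB (Ideal.subset_span rfl)
  have hf1 : 1 < v.comap φ f := by
    by_contra hle
    have : v (φ f) * v y < 1 := (mul_le_mul_left (not_lt.1 hle) _).trans_lt (by simpa using hy1)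
    rw [← map_mul, hy, map_one] at this
    exact lt_irrefl _ this
  -- Smallness on `J` comes for free: `f * j ^ n ∈ W` for some `n` while `f` has value above `1`.
  -- The value of `f` survives the retraction because it is at least `1`.
  obtain ⟨v', hv', hle, heq⟩ := h.exists_isContinuousVal (v.comap φ) hW fun j hj => by
    obtain ⟨n, hn⟩ := h.absorbs f j hj
    by_contra hj1
    have h1 := hW _ hn
    rw [map_mul, map_pow] at h1
    have h2 : (1 : Γ₀) ≤ v.comap φ (j : C) ^ n := one_le_pow_of_one_le' (not_lt.1 hj1) n
    exact absurd h1 (not_le.2 (hf1.trans_le (le_mul_of_one_le_right' h2)))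
  have := hf _ hv' fun w hw => by
    change v' w ≤ v' 1
    rw [map_one]
    exact (hle w).trans (hW w hw)
  change v' f ≤ v' 1 at this
  rw [map_one, heq f hf1.le] at this
  exact absurd this (not_le.2 hf1)

end Continuity

/-! ### Bounded and power-bounded sets. -/

section Bounded

variable {R : Type u} [CommRing R] [TopologicalSpace R]

theorem IsBoundedSet.mono {S T : Set R} (hT : IsBoundedSet T) (h : S ⊆ T) : IsBoundedSet S :=
  fun U hU =>
    let ⟨V, hV, H⟩ := hT U hU
    ⟨V, hV, fun x hx y hy => H x hx y (h hy)⟩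

theorem IsPowerBoundedSet.mono {S T : Set R} (hT : IsPowerBoundedSet T) (h : S ⊆ T) :
    IsPowerBoundedSet S :=
  IsBoundedSet.mono hT (Submonoid.closure_mono h)

theorem IsBoundedSet.union {S T : Set R} (hS : IsBoundedSet S) (hT : IsBoundedSet T) :
    IsBoundedSet (S ∪ T) := fun U hU => by
  obtain ⟨V, hV, H⟩ := hS U hU
  obtain ⟨V', hV', H'⟩ := hT U hU
  refine ⟨V ∩ V', Filter.inter_mem hV hV', fun x hx y hy => ?_⟩
  rcases hy with hy | hy
  exacts [H x hx.1 y hy, H' x hx.2 y hy]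

theorem isBoundedSet_singleton [IsTopologicalRing R] (a : R) : IsBoundedSet {a} := fun U hU => by
  have h : Filter.Tendsto (fun x : R => x * a) (𝓝 0) (𝓝 0) := by
    simpa using (continuous_mul_const a).tendsto 0
  exact ⟨_, h hU, fun x hx y hy => by rw [Set.mem_singleton_iff.1 hy]; exact hx⟩

theorem isBoundedSet_of_finite [IsTopologicalRing R] {S : Set R} (hS : S.Finite) :
    IsBoundedSet S := by
  induction S, hS using Set.Finite.induction_on with
  | empty => exact fun U hU => ⟨U, hU, fun x _ y hy => hy.elim⟩
  | insert _ _ ih => exact (isBoundedSet_singleton _).union ih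

open scoped Pointwise in
theorem IsBoundedSet.mul {S T : Set R} (hS : IsBoundedSet S) (hT : IsBoundedSet T) :
    IsBoundedSet (S * T) := fun U hU => by
  obtain ⟨V, hV, H⟩ := hT U hU
  obtain ⟨V', hV', H'⟩ := hS V hV
  refine ⟨V', hV', ?_⟩
  rintro x hx _ ⟨a, ha, b, hb, rfl⟩
  rw [← mul_assoc]
  exact H _ (H' x hx a ha) b hb

theorem IsBoundedSet.addSubgroupClosure [NonarchimedeanRing R] {S : Set R} (hS : IsBoundedSet S) :
    IsBoundedSet (AddSubgroup.closure S : Set R) := fun U hU => by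
  obtain ⟨G, hG⟩ := NonarchimedeanRing.is_nonarchimedean U hU
  obtain ⟨V, hV, H⟩ := hS G (G.isOpen.mem_nhds G.zero_mem)
  refine ⟨V, hV, fun x hx y hy => hG ?_⟩
  have : AddSubgroup.closure S ≤ G.toAddSubgroup.comap (AddMonoidHom.mulLeft x) :=
    (AddSubgroup.closure_le _).2 fun y hy => H x hx y hy
  exact this hy

theorem IsBoundedSet.closure [IsTopologicalRing R] {S : Set R} (hS : IsBoundedSet S) :
    IsBoundedSet (closure S) := fun U hU => by
  obtain ⟨K, ⟨hK, hKc⟩, hKU⟩ := (closed_nhds_basis (0 : R)).mem_iff.1 hU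
  obtain ⟨V, hV, H⟩ := hS K hK
  refine ⟨V, hV, fun x hx y hy => hKU ?_⟩
  have hc : IsClosed {y : R | x * y ∈ K} := hKc.preimage (continuous_const_mul x)
  exact closure_minimal (fun y hy => H x hx y hy) hc hy

theorem isPowerBoundedSet_of_subset_subring {S : Set R} {P : Subring R}
    (hP : IsBoundedSet (P : Set R)) (hS : S ⊆ P) : IsPowerBoundedSet S :=
  hP.mono ((Submonoid.closure_le (S := P.toSubmonoid)).2 hS)

theorem IsPowerBoundedSet.isBoundedSet_subringClosure [NonarchimedeanRing R] {S : Set R}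
    (hS : IsPowerBoundedSet S) : IsBoundedSet (Subring.closure S : Set R) :=
  (IsBoundedSet.addSubgroupClosure hS).mono fun _ hx => Subring.mem_closure_iff.1 hx

theorem IsPowerBoundedSet.union [NonarchimedeanRing R] {S T : Set R} (hS : IsPowerBoundedSet S)
    (hT : IsPowerBoundedSet T) : IsPowerBoundedSet (S ∪ T) := by
  refine (IsBoundedSet.mul hS hT).mono fun x hx => ?_
  rw [Submonoid.closure_union, SetLike.mem_coe, Submonoid.mem_sup] at hx
  obtain ⟨y, hy, z, hz, rfl⟩ := hx
  exact Set.mul_mem_mul hy hz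

theorem isPowerBoundedSet_of_finite [NonarchimedeanRing R] {S : Set R} (hS : S.Finite)
    (h : ∀ a ∈ S, IsPowerBoundedSet {a}) : IsPowerBoundedSet S := by
  induction S, hS using Set.Finite.induction_on with
  | empty =>
    refine (isBoundedSet_singleton (1 : R)).mono ?_
    simp
  | insert _ _ ih =>
    exact (h _ (Set.mem_insert _ _)).union (ih fun a ha => h a (Set.mem_insert_of_mem _ ha))

/-- An element that is integral over a bounded subring is power-bounded. -/
theorem isPowerBoundedSet_singleton_of_isIntegral [NonarchimedeanRing R] {P : Subring R}
    (hP : IsBoundedSet (P : Set R)) {x : R} (hx : IsIntegral P x) :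
    IsPowerBoundedSet {x} := by
  obtain ⟨F, hF⟩ := hx.fg_adjoin_singleton
  have hb : IsBoundedSet ((Algebra.adjoin P {x}).toSubring : Set R) := by
    -- `P[x]` is a finite `P`-module, so it lies in the additive group generated by the bounded set
    -- `P * F`.
    refine ((hP.mul (isBoundedSet_of_finite F.finite_toSet)).addSubgroupClosure).mono fun y hy => ?_
    have hy' : y ∈ Submodule.span P (F : Set R) := by rw [hF]; exact hy
    induction hy' using Submodule.span_induction with
    | mem y hy' =>
      exact AddSubgroup.subset_closure ⟨1, P.one_mem, y, hy', one_mul y⟩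
    | zero => exact zero_mem _
    | add y z hy' hz' ihy ihz =>
      rw [hF] at hy' hz'
      exact add_mem (ihy hy') (ihz hz')
    | smul p y hy' ih =>
      rw [hF] at hy'
      have h := ih hy'
      clear ih hy hy'
      induction h using AddSubgroup.closure_induction with
      | mem y hy =>
        obtain ⟨q, hq, f, hf, rfl⟩ := hy
        exact AddSubgroup.subset_closure
          ⟨p * q, P.mul_mem p.2 hq, f, hf, by simp [Subring.smul_def, mul_assoc]⟩
      | zero => rw [smul_zero]; exact zero_mem _
      | add y z _ _ ihy ihz => rw [smul_add]; exact add_mem ihy ihz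
      | neg y _ ih => rw [smul_neg]; exact neg_mem ih
  exact isPowerBoundedSet_of_subset_subring hb
    (Set.singleton_subset_iff.2 (Algebra.self_mem_adjoin_singleton P x))

open Polynomial in
/-- An element that is integral over a subring of power-bounded elements is power-bounded. -/
theorem isPowerBoundedSet_singleton_of_isIntegral' [NonarchimedeanRing R] {W : Subring R}
    (hW : ∀ a ∈ W, IsPowerBoundedSet {a}) {x : R} (hx : IsIntegral W x) :
    IsPowerBoundedSet {x} := by
  obtain ⟨p, hp, hpx⟩ := hx
  -- `W` itself may be unbounded, but the finitely many coefficients of the equation generate a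
  -- bounded subring, over which `x` is still integral.
  let q : R[X] := p.map W.subtype
  let P : Subring R := Subring.closure (q.coeffs : Set R)
  have hqW : ∀ a ∈ q.coeffs, a ∈ W := fun a ha => by
    obtain ⟨n, -, rfl⟩ := mem_coeffs_iff.1 ha
    rw [coeff_map]
    exact (p.coeff n).2
  have hP : IsBoundedSet (P : Set R) :=
    (isPowerBoundedSet_of_finite q.coeffs.finite_toSet fun a ha =>
      hW a (hqW a ha)).isBoundedSet_subringClosure
  have hsub : (q.coeffs : Set R) ⊆ P := Subring.subset_closure
  refine isPowerBoundedSet_singleton_of_isIntegral hP ⟨q.toSubring P hsub, ?_, ?_⟩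
  · exact (monic_toSubring q P hsub).2 (hp.map _)
  · rw [← Polynomial.eval_map]
    have : (q.toSubring P hsub).map (algebraMap P R) = q := map_toSubring q P hsub
    rw [this, Polynomial.eval_map]
    exact hpx

theorem isPowerBoundedSet_induced {S : Type w} [CommRing S] (f : S →+* R) {F : Set S}
    (h : IsPowerBoundedSet (f '' F)) :
    @IsPowerBoundedSet S _ (TopologicalSpace.induced f ‹_›) F := by
  intro U hU
  rw [nhds_induced, map_zero, Filter.mem_comap] at hU
  obtain ⟨U', hU', hU⟩ := hU
  obtain ⟨V, hV, H⟩ := h U' hU'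
  refine ⟨f ⁻¹' V, ?_, fun x hx y hy => hU ?_⟩
  · rw [nhds_induced, map_zero]
    exact Filter.preimage_mem_comap hV
  · rw [Set.mem_preimage, map_mul]
    refine H _ hx _ ?_
    have := MonoidHom.map_mclosure (f : S →* R) F
    change Submonoid.map (f : S →* R) (Submonoid.closure F) = Submonoid.closure (f '' F) at this
    rw [← this]
    exact ⟨y, hy, rfl⟩

-- Closed neighbourhoods suffice, and products with a fixed element are continuous. So the bound for
-- `V` passes to the closure of its image, which is a neighbourhood by density.
open UniformSpace in
theorem IsBoundedSet.completion {S : Type u} [CommRing S] [UniformSpace S] [IsUniformAddGroup S]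
    [IsTopologicalRing S] {F : Set S} (hF : IsBoundedSet F) :
    IsBoundedSet ((Completion.coeRingHom : S →+* Completion S) '' F) := by
  set ι : S →+* Completion S := Completion.coeRingHom with hι
  have hd : IsDenseInducing ι := Completion.isDenseInducing_coe
  intro U hU
  obtain ⟨K, ⟨hK, hKc⟩, hKU⟩ := (closed_nhds_basis (0 : Completion S)).mem_iff.1 hU
  have hK' : ι ⁻¹' K ∈ 𝓝 (0 : S) :=
    hd.continuous.continuousAt.preimage_mem_nhds (by rwa [map_zero])
  obtain ⟨V, hV, H⟩ := hF _ hK'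
  refine ⟨_root_.closure (ι '' V), ?_, ?_⟩
  · rw [← map_zero ι]
    exact hd.closure_image_mem_nhds hV
  · rintro x hx _ ⟨y, hy, rfl⟩
    refine hKU ?_
    have hc : IsClosed {x : Completion S | x * ι y ∈ K} :=
      hKc.preimage (continuous_mul_const _)
    refine closure_minimal ?_ hc hx
    rintro _ ⟨v, hv, rfl⟩
    have := H v hv y hy
    rwa [Set.mem_preimage, map_mul] at this

open UniformSpace in
theorem IsPowerBoundedSet.completion {S : Type u} [CommRing S] [UniformSpace S]
    [IsUniformAddGroup S] [IsTopologicalRing S] {F : Set S} (hF : IsPowerBoundedSet F) :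
    IsPowerBoundedSet ((Completion.coeRingHom : S →+* Completion S) '' F) := by
  refine (IsBoundedSet.completion hF).mono fun x hx => ?_
  have := MonoidHom.map_mclosure ((Completion.coeRingHom : S →+* Completion S) : S →* Completion S) F
  change Submonoid.map _ (Submonoid.closure F) = Submonoid.closure
    ((Completion.coeRingHom : S →+* Completion S) '' F) at this
  rw [← this] at hx
  exact hx

/-- In a complete separated ring, `1 - j` is invertible for `j` topologically nilpotent, and the
inverse lies in every closed subring containing `j`. -/
theorem exists_mul_one_sub_eq_one {S : Type u} [CommRing S] [UniformSpace S] [IsUniformAddGroup S]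
    [NonarchimedeanRing S] [CompleteSpace S] [T2Space S] {P : Subring S} (hP : IsClosed (P : Set S))
    {j : S} (hjP : j ∈ P) (hj : Filter.Tendsto (fun n : ℕ => j ^ n) Filter.atTop (𝓝 0)) :
    ∃ u ∈ P, (1 - j) * u = 1 := by
  -- In a complete non-Archimedean group, terms tending to `0` are summable.
  have hs : Summable fun n : ℕ => j ^ n :=
    NonarchimedeanAddGroup.summable_of_tendsto_cofinite_zero (by rwa [Nat.cofinite_eq_atTop])
  obtain ⟨u, hu⟩ := hs
  have ht := hu.tendsto_sum_nat
  refine ⟨u, hP.mem_of_tendsto ht (Filter.Eventually.of_forall fun n =>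
    sum_mem fun i _ => pow_mem hjP i), ?_⟩
  have h1 : Filter.Tendsto (fun n : ℕ => (1 - j) * ∑ i ∈ Finset.range n, j ^ i) Filter.atTop
      (𝓝 ((1 - j) * u)) := ht.const_mul _
  have h2 : Filter.Tendsto (fun n : ℕ => (1 - j) * ∑ i ∈ Finset.range n, j ^ i) Filter.atTop
      (𝓝 1) := by
    simp_rw [mul_neg_geom_sum]
    simpa using hj.const_sub 1
  exact tendsto_nhds_unique h1 h2

end Bounded

/-! ### The topology of `A(T/s)` and its universal property. -/

section Localization

theorem nonarchimedeanRing_induced {R : Type u} {S : Type v} [CommRing R] [CommRing S]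
    [TopologicalSpace R] [NonarchimedeanRing R] (f : S →+* R) :
    @NonarchimedeanRing S _ (TopologicalSpace.induced f ‹_›) := by
  let := TopologicalSpace.induced f ‹_›
  have h1 : ContinuousAdd S := continuousAdd_induced f
  have h2 : ContinuousMul S := continuousMul_induced f
  have h3 : ContinuousNeg S := ⟨continuous_induced_rng.2 (by
    rw [show f ∘ (fun x : S => -x) = fun x => -f x from funext fun x => map_neg f x]
    exact continuous_induced_dom.neg)⟩
  have h : IsTopologicalRing S := { }
  refine { h with is_nonarchimedean := fun U hU => ?_ }
  rw [nhds_induced, map_zero, Filter.mem_comap] at hU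
  obtain ⟨U', hU', hU⟩ := hU
  obtain ⟨G, hG⟩ := NonarchimedeanRing.is_nonarchimedean U' hU'
  exact ⟨G.comap (f : S →+ R) continuous_induced_dom, fun x hx => hU (hG hx)⟩

namespace RatLoc

variable {A : Type u} [CommRing A] [TopologicalSpace A] (D : RationalDatum A)

/-- Reduces statements about the finest admissible topology to single admissible topologies, via
finite intersections of their neighbourhoods. -/
theorem nhds_zero_eq :
    𝓝 (0 : RatLoc D) = ⨅ τ : {τ // IsAdmissible D τ}, @nhds _ τ.1 0 := by
  rw [iInf_subtype]
  exact nhds_sInf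

theorem topology_le {τ : TopologicalSpace (RatLoc D)} (h : IsAdmissible D τ) : topology D ≤ τ :=
  sInf_le h

variable {D} in
theorem IsAdmissible.exists_isOpen_addSubgroup {τ : TopologicalSpace (RatLoc D)}
    (h : IsAdmissible D τ) {s : Set (RatLoc D)} (hs : s ∈ @nhds _ τ 0) :
    ∃ G : AddSubgroup (RatLoc D), @IsOpen _ (topology D) (G : Set (RatLoc D)) ∧
      (G : Set (RatLoc D)) ⊆ s := by
  obtain ⟨G, hG⟩ := h.1.is_nonarchimedean s hs
  exact ⟨G.toAddSubgroup, (topology_le D h) _ G.isOpen', hG⟩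

instance : NonarchimedeanRing (RatLoc D) where
  is_nonarchimedean U hU := by
    rw [nhds_zero_eq] at hU
    suffices h : ∃ G : AddSubgroup (RatLoc D), IsOpen (G : Set (RatLoc D)) ∧
        (G : Set (RatLoc D)) ⊆ U by
      obtain ⟨G, hG, hGU⟩ := h
      exact ⟨⟨G, hG⟩, hGU⟩
    refine Filter.iInf_sets_induct hU ⟨⊤, isOpen_univ, Set.subset_univ _⟩ ?_
    rintro τ s₁ s₂ hs₁ ⟨G₂, ho₂, hG₂⟩
    obtain ⟨G₁, ho₁, hG₁⟩ := IsAdmissible.exists_isOpen_addSubgroup τ.2 hs₁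
    exact ⟨G₁ ⊓ G₂, ho₁.inter ho₂, fun x hx => ⟨hG₁ hx.1, hG₂ hx.2⟩⟩

theorem continuous_algebraMap : Continuous (algebraMap A (RatLoc D)) :=
  continuous_sInf_rng.2 fun _ hτ => hτ.2.1

theorem isPowerBoundedSet_fractions : IsPowerBoundedSet (fractions D) := fun U hU => by
  rw [nhds_zero_eq] at hU
  refine Filter.iInf_sets_induct hU ⟨Set.univ, Filter.univ_mem, fun _ _ _ _ => trivial⟩ ?_
  rintro ⟨τ, hτ⟩ s₁ s₂ hs₁ ⟨V₂, hV₂, H₂⟩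
  obtain ⟨V₁, hV₁, H₁⟩ := hτ.2.2 s₁ hs₁
  refine ⟨V₁ ∩ V₂, Filter.inter_mem ?_ hV₂, fun x hx y hy => ⟨H₁ x hx.1 y hy, H₂ x hx.2 y hy⟩⟩
  exact nhds_mono (topology_le D hτ) hV₁

theorem isUnit_algebraMap_s : IsUnit (algebraMap A (RatLoc D) D.s) :=
  IsLocalization.Away.algebraMap_isUnit D.s

theorem ringHom_ext {B : Type v} [CommRing B] {g g' : RatLoc D →+* B}
    (h : g.comp (algebraMap A (RatLoc D)) = g'.comp (algebraMap A (RatLoc D))) : g = g' :=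
  IsLocalization.ringHom_ext (Submonoid.powers D.s) h

/-- The universal property of `A(T/s)`. -/
theorem existsUnique_lift {B : Type v} [CommRing B] [TopologicalSpace B] [NonarchimedeanRing B]
    (f : A →+* B) (b : Bˣ) (hf : Continuous f) (hb : (b : B) = f D.s)
    (hpb : IsPowerBoundedSet ((fun t : A => f t * ((b⁻¹ : Bˣ) : B)) '' (D.T : Set A))) :
    ∃! g : RatLoc D →+* B, Continuous g ∧ g.comp (algebraMap A (RatLoc D)) = f := by
  have hu : IsUnit (f D.s) := hb ▸ b.isUnit
  let g : RatLoc D →+* B := IsLocalization.Away.lift D.s hu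
  have hg : g.comp (algebraMap A (RatLoc D)) = f := IsLocalization.Away.lift_comp D.s hu
  have hga : ∀ a, g (algebraMap A (RatLoc D) a) = f a := fun a => DFunLike.congr_fun hg a
  refine ⟨g, ⟨?_, hg⟩, fun g' hg' => ringHom_ext D (hg'.2.trans hg.symm)⟩
  -- Continuity of `g` says that the topology pulled back from `B` is coarser than `topology D`; it
  -- is so because it is admissible.
  refine continuous_iff_le_induced.2 (topology_le D ⟨nonarchimedeanRing_induced g, ?_, ?_⟩)
  · refine continuous_induced_rng.2 ?_
    rw [show g ∘ algebraMap A (RatLoc D) = f from funext hga]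
    exact hf
  · refine isPowerBoundedSet_induced g ?_
    have hinv : g (IsLocalization.Away.invSelf D.s) = ((b⁻¹ : Bˣ) : B) := by
      rw [← Units.mul_right_inj b, Units.mul_inv, hb, ← hga, ← map_mul,
        IsLocalization.Away.mul_invSelf, map_one]
    rw [fractions, Set.image_image]
    simpa only [map_mul, hga, hinv] using hpb

end RatLoc

end Localization

/-! ### Adic filtrations and an explicit basis of neighbourhoods of `0` in `A(T/s)`. -/

section AdicFiltrations

variable {A : Type u} [CommRing A] [TopologicalSpace A]

/-- The additive subgroups `P n` behave like the powers of a finitely generated ideal of definition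
of a Huber ring. -/
structure IsAdicFiltration (P : ℕ → Submodule ℤ A) : Prop where
  hasBasis : (𝓝 (0 : A)).HasBasis (fun _ => True) fun n => (P n : Set A)
  antitone : Antitone P
  mul_le : ∀ m n, P m * P n ≤ P (m + n)
  exists_span : ∃ F : Finset A, Submodule.span ℤ (F : Set A) ≤ P 1 ∧
    ∀ k, P (k + 1) ≤ Submodule.span ℤ (F : Set A) * P k

/-- A Huber ring has an adic filtration inside any given open neighbourhood of `0`. -/
theorem IsHuberRing.exists_isAdicFiltration (h : IsHuberRing A) {U : Set A} (hU : U ∈ 𝓝 0) :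
    ∃ P : ℕ → Submodule ℤ A, IsAdicFiltration P ∧ (P 1 : Set A) ⊆ U := by
  classical
  obtain ⟨hA, A₀, hA₀, I', hfg', hI'⟩ := h
  have hpre : (Subtype.val ⁻¹' U : Set A₀) ∈ 𝓝 0 :=
    continuous_subtype_val.continuousAt.preimage_mem_nhds hU
  obtain ⟨m, -, hm⟩ := hI'.hasBasis_nhds_zero.mem_iff.1 hpre
  obtain ⟨I, hfg, hI, hIU⟩ : ∃ I : Ideal A₀, I.FG ∧ IsAdic I ∧
      (I : Set A₀) ⊆ Subtype.val ⁻¹' U :=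
    -- The exponent `m + 1` is positive even when `m = 0`, so the power still defines the topology.
    ⟨I' ^ (m + 1), hfg'.pow, is_ideal_adic_pow hI' m.succ_pos,
      fun x hx => hm (Ideal.pow_le_pow_right m.le_succ hx)⟩
  let P : ℕ → Submodule ℤ A := fun n =>
    AddSubgroup.toIntSubmodule (((I ^ n).toAddSubgroup).map (A₀.subtype : A₀ →+ A))
  have hP : ∀ n x, x ∈ P n ↔ ∃ y ∈ I ^ n, (y : A) = x := fun n x => Iff.rfl
  refine ⟨P, ⟨?_, ?_, ?_, ?_⟩, ?_⟩
  · have h1 := hI.hasBasis_nhds_zero.map (Subtype.val : A₀ → A)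
    have h2 : Filter.map (Subtype.val : A₀ → A) (𝓝 0) = 𝓝 (0 : A) :=
      hA₀.isOpenEmbedding_subtypeVal.map_nhds_eq 0
    rw [h2] at h1
    exact h1
  · rintro m n hmn _ ⟨y, hy, rfl⟩
    exact ⟨y, Ideal.pow_le_pow_right hmn hy, rfl⟩
  · intro m n
    rw [Submodule.mul_le]
    rintro _ ⟨y, hy, rfl⟩ _ ⟨z, hz, rfl⟩
    exact ⟨y * z, by rw [pow_add]; exact Ideal.mul_mem_mul hy hz, rfl⟩
  · obtain ⟨F, rfl⟩ := hfg
    refine ⟨F.image Subtype.val, ?_, fun k => ?_⟩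
    · rw [Submodule.span_le]
      intro x hx
      obtain ⟨y, hy, rfl⟩ := Finset.mem_image.1 (Finset.mem_coe.1 hx)
      exact ⟨y, by rw [pow_one]; exact Ideal.subset_span hy, rfl⟩
    · rintro _ ⟨x, hx, rfl⟩
      change x ∈ Ideal.span (F : Set A₀) ^ (k + 1) at hx
      rw [pow_succ'] at hx
      induction hx using Submodule.mul_induction_on' with
      | add x _ y _ hx hy =>
        rw [map_add]
        exact add_mem hx hy
      | mem_mul_mem a ha b hb =>
        induction ha using Submodule.span_induction generalizing b with
        | mem a ha =>
          exact Submodule.mul_mem_mul (Submodule.subset_span (by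
            rw [Finset.coe_image]; exact ⟨a, ha, rfl⟩)) ⟨b, hb, rfl⟩
        | zero => simp
        | add x y _ _ hx hy =>
          rw [add_mul, map_add]
          exact add_mem (hx b hb) (hy b hb)
        | smul c x _ hx =>
          have := hx (c * b) (Ideal.mul_mem_left _ c hb)
          rwa [smul_eq_mul, mul_comm c x, mul_assoc]
  · rintro _ ⟨x, hx, rfl⟩
    change x ∈ I ^ 1 at hx
    rw [pow_one] at hx
    exact hIU hx

namespace IsAdicFiltration

variable {P : ℕ → Submodule ℤ A} (hP : IsAdicFiltration P)

include hP

theorem mem_nhds (n : ℕ) : (P n : Set A) ∈ 𝓝 0 := hP.hasBasis.mem_of_mem trivial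

theorem exists_mul_mem [IsTopologicalRing A] (a : A) (i : ℕ) : ∃ j, ∀ y ∈ P j, a * y ∈ P i := by
  have h : Filter.Tendsto (fun x : A => a * x) (𝓝 0) (𝓝 0) := by
    simpa using (continuous_const_mul a).tendsto 0
  obtain ⟨j, -, hj⟩ := hP.hasBasis.mem_iff.1 (h (hP.mem_nhds i))
  exact ⟨j, fun y hy => hj hy⟩

/-- Iterating `exists_span` with one `F` for all powers. The exponents start at `1` because `1 ∈ P
0` is not part of the structure. -/
theorem exists_span_pow : ∃ F : Finset A, ∀ n, Submodule.span ℤ (F : Set A) ^ (n + 1) ≤ P (n + 1) ∧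
    ∀ k, P (n + 1 + k) ≤ Submodule.span ℤ (F : Set A) ^ (n + 1) * P k := by
  obtain ⟨F, hF1, hF⟩ := hP.exists_span
  refine ⟨F, fun n => ?_⟩
  induction n with
  | zero => exact ⟨by simpa using hF1, fun k => by simpa [add_comm] using hF k⟩
  | succ n ih =>
    refine ⟨?_, fun k => ?_⟩
    · rw [pow_succ]
      exact (mul_le_mul' ih.1 hF1).trans (hP.mul_le _ _)
    · rw [pow_succ', mul_assoc, show n + 1 + 1 + k = (n + 1 + k) + 1 by ring]
      exact (hF _).trans (mul_le_mul_right (ih.2 k) _)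

theorem mul_self_le (n : ℕ) : P n * P n ≤ P n :=
  (hP.mul_le n n).trans (hP.antitone (Nat.le_add_left n n))

/-- An open ideal absorbs the filtration: if `T · A` is open, then `T · P i` is open. -/
theorem exists_le_span_mul [IsTopologicalRing A] {T : Set A}
    (hT : IsOpen (Ideal.span T : Set A)) (i : ℕ) :
    ∃ j, P j ≤ Submodule.span ℤ T * P i := by
  -- The elements that multiply some `P k` into `T · P i` form an ideal. It contains `T`, hence the
  -- open ideal `T · A`, hence some `P m`.
  let Q : Ideal A :=
    { carrier := {x | ∃ k, ∀ y ∈ P k, x * y ∈ Submodule.span ℤ T * P i}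
      zero_mem' := ⟨0, by simp⟩
      add_mem' := by
        rintro x y ⟨k, hk⟩ ⟨l, hl⟩
        refine ⟨max k l, fun z hz => ?_⟩
        rw [add_mul]
        exact add_mem (hk z (hP.antitone (le_max_left k l) hz))
          (hl z (hP.antitone (le_max_right k l) hz))
      smul_mem' := by
        rintro c x ⟨k, hk⟩
        obtain ⟨l, hl⟩ := hP.exists_mul_mem c k
        refine ⟨l, fun y hy => ?_⟩
        rw [smul_eq_mul, mul_comm c x, mul_assoc]
        exact hk _ (hl y hy) }
  have hTQ : Ideal.span T ≤ Q := Ideal.span_le.2 fun t ht =>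
    ⟨i, fun y hy => Submodule.mul_mem_mul (Submodule.subset_span ht) hy⟩
  obtain ⟨m, -, hm⟩ := hP.hasBasis.mem_iff.1 (hT.mem_nhds (zero_mem _))
  obtain ⟨F, hF⟩ := hP.exists_span_pow
  obtain ⟨hF1, hF2⟩ := hF m
  have hQ : ∀ x ∈ Submodule.span ℤ (F : Set A) ^ (m + 1), x ∈ Q := fun x hx =>
    hTQ (hm (hP.antitone m.le_succ (hF1 hx)))
  obtain ⟨G, hG⟩ := (Submodule.fg_span (R := ℤ) F.finite_toSet).pow (m + 1)
  rw [← hG] at hF2 hQ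
  -- The index `k` depends on the element of `Q`. Finite generation of the power of `span F` makes
  -- one `k` serve for all of it.
  have hfin : ∀ G : Finset A, (∀ x ∈ G, x ∈ Q) →
      ∃ k, Submodule.span ℤ (G : Set A) * P k ≤ Submodule.span ℤ T * P i := by
    classical
    intro G
    induction G using Finset.induction_on with
    | empty => exact fun _ => ⟨0, by simp⟩
    | insert x G _ ih =>
      intro hx
      obtain ⟨k, hk⟩ := ih fun y hy => hx y (Finset.mem_insert_of_mem hy)
      obtain ⟨l, hl⟩ := hx x (Finset.mem_insert_self x G)
      refine ⟨max k l, ?_⟩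
      rw [Finset.coe_insert, Submodule.span_insert, Submodule.sup_mul]
      refine sup_le ?_ ((mul_le_mul_right (hP.antitone (le_max_left k l)) _).trans hk)
      rw [Submodule.mul_le]
      intro y hy z hz
      obtain ⟨c, rfl⟩ := Submodule.mem_span_singleton.1 hy
      rw [smul_mul_assoc]
      exact Submodule.smul_mem _ c (hl z (hP.antitone (le_max_right k l) hz))
  obtain ⟨k, hk⟩ := hfin G fun x hx => hQ x (Submodule.subset_span hx)
  exact ⟨m + 1 + k, (hF2 k).trans hk⟩

end IsAdicFiltration

namespace RatLoc

variable (D : RationalDatum A)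

/-- The subring of `A[1/s]` generated by the fractions `t/s`, as an additive subgroup. -/
def fractionsSpan : Submodule ℤ (RatLoc D) :=
  Submodule.span ℤ (Submonoid.closure (fractions D) : Set (RatLoc D))

theorem one_mem_fractionsSpan : (1 : RatLoc D) ∈ fractionsSpan D :=
  Submodule.subset_span (one_mem _)

theorem fractions_subset_fractionsSpan : fractions D ⊆ fractionsSpan D :=
  Submonoid.subset_closure.trans Submodule.subset_span

theorem fractionsSpan_mul_self : fractionsSpan D * fractionsSpan D ≤ fractionsSpan D := by
  rw [fractionsSpan, Submodule.span_mul_span]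
  refine Submodule.span_mono ?_
  rintro _ ⟨a, ha, b, hb, rfl⟩
  exact mul_mem ha hb

/-- The localisation map as a homomorphism of `ℤ`-algebras. -/
def mapInt : A →ₐ[ℤ] RatLoc D := (algebraMap A (RatLoc D)).toIntAlgHom

/-- The neighbourhoods of `0` in `A(T/s)` defined by an adic filtration of `A`. -/
def nhd (P : ℕ → Submodule ℤ A) (n : ℕ) : Submodule ℤ (RatLoc D) :=
  (P n).map (mapInt D).toLinearMap * fractionsSpan D

variable {D} {P : ℕ → Submodule ℤ A} (hP : IsAdicFiltration P)

theorem algebraMap_mem_nhd {n : ℕ} {a : A} (ha : a ∈ P n) :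
    algebraMap A (RatLoc D) a ∈ nhd D P n := by
  rw [← mul_one (algebraMap A (RatLoc D) a)]
  exact Submodule.mul_mem_mul ⟨a, ha, rfl⟩ (one_mem_fractionsSpan D)

theorem mul_mem_nhd {n : ℕ} {x y : RatLoc D} (hx : x ∈ nhd D P n) (hy : y ∈ fractionsSpan D) :
    x * y ∈ nhd D P n := by
  have := Submodule.mul_mem_mul hx hy
  rw [nhd, mul_assoc] at this
  exact mul_le_mul_right (fractionsSpan_mul_self D) _ this

include hP

theorem nhd_antitone : Antitone (nhd D P) := fun _ _ h =>
  mul_le_mul_left (Submodule.map_mono (hP.antitone h)) _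

/-- Every `x` is `a * (1/s) ^ n`. Multiplication by `a` is continuous on `A`. For `1/s`, use `P j ⊆
T · P i` and absorb `T · (1/s)` into `fractionsSpan D`. -/
theorem exists_mul_mem_nhd [IsTopologicalRing A] (x : RatLoc D) (i : ℕ) :
    ∃ j, ∀ y ∈ nhd D P j, x * y ∈ nhd D P i := by
  have halg : ∀ (a : A) (i : ℕ), ∃ j, ∀ y ∈ nhd D P j, algebraMap A (RatLoc D) a * y ∈ nhd D P i := by
    intro a i
    obtain ⟨j, hj⟩ := hP.exists_mul_mem a i
    refine ⟨j, fun y hy => ?_⟩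
    induction hy using Submodule.mul_induction_on' with
    | mem_mul_mem p hp m hm =>
      obtain ⟨p, hp, rfl⟩ := hp
      rw [← mul_assoc]
      exact Submodule.mul_mem_mul ⟨a * p, hj p hp, map_mul (mapInt D) a p⟩ hm
    | add y _ z _ hy hz => rw [mul_add]; exact add_mem hy hz
  let u : RatLoc D := IsLocalization.Away.invSelf D.s
  have hu : ∀ i : ℕ, ∃ j, ∀ y ∈ nhd D P j, u * y ∈ nhd D P i := by
    intro i
    obtain ⟨j, hj⟩ := hP.exists_le_span_mul D.isOpen_span i
    refine ⟨j, fun y hy => ?_⟩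
    have h1 : u * y ∈ Submodule.span ℤ {u} * nhd D P j :=
      Submodule.mul_mem_mul (Submodule.mem_span_singleton_self u) hy
    have h2 : Submodule.span ℤ {u} * (Submodule.span ℤ (D.T : Set A)).map (mapInt D).toLinearMap ≤
        fractionsSpan D := by
      rw [Submodule.map_span, Submodule.span_mul_span, Submodule.span_le]
      rintro _ ⟨_, rfl, _, ⟨t, ht, rfl⟩, rfl⟩
      exact fractions_subset_fractionsSpan D ⟨t, ht, mul_comm _ _⟩
    have h3 : Submodule.span ℤ {u} * nhd D P j ≤ nhd D P i := calc
      Submodule.span ℤ {u} * nhd D P j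
        ≤ Submodule.span ℤ {u} * ((Submodule.span ℤ (D.T : Set A) * P i).map
            (mapInt D).toLinearMap * fractionsSpan D) :=
          mul_le_mul_right (mul_le_mul_left (Submodule.map_mono hj) _) _
      _ = (Submodule.span ℤ {u} * (Submodule.span ℤ (D.T : Set A)).map (mapInt D).toLinearMap) *
            fractionsSpan D * (P i).map (mapInt D).toLinearMap := by
          rw [Submodule.map_mul]; ac_rfl
      _ ≤ fractionsSpan D * (P i).map (mapInt D).toLinearMap :=
          mul_le_mul_left ((mul_le_mul_left h2 _).trans (fractionsSpan_mul_self D)) _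
      _ = nhd D P i := mul_comm _ _
    exact h3 h1
  have hun : ∀ (n i : ℕ), ∃ j, ∀ y ∈ nhd D P j, u ^ n * y ∈ nhd D P i := by
    intro n
    induction n with
    | zero => exact fun i => ⟨i, by simp⟩
    | succ n ih =>
      intro i
      obtain ⟨k, hk⟩ := hu i
      obtain ⟨j, hj⟩ := ih k
      exact ⟨j, fun y hy => by rw [pow_succ', mul_assoc]; exact hk _ (hj y hy)⟩
  obtain ⟨n, a, ha⟩ := IsLocalization.Away.surj D.s x
  have hx : x = algebraMap A (RatLoc D) a * u ^ n := by
    rw [← ha, mul_assoc, ← mul_pow, IsLocalization.Away.mul_invSelf, one_pow, mul_one]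
  obtain ⟨k, hk⟩ := halg a i
  obtain ⟨j, hj⟩ := hun n k
  exact ⟨j, fun y hy => by rw [hx, mul_assoc]; exact hk _ (hj y hy)⟩

open scoped Pointwise in
theorem nhd_ringSubgroupsBasis [IsTopologicalRing A] :
    RingSubgroupsBasis fun n => (nhd D P n).toAddSubgroup := by
  refine RingSubgroupsBasis.of_comm _ (fun i j => ?_) (fun i => ⟨i, ?_⟩) fun x i => ?_
  · exact ⟨max i j, le_inf (nhd_antitone hP (le_max_left i j)) (nhd_antitone hP (le_max_right i j))⟩
  · rintro _ ⟨x, hx, y, hy, rfl⟩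
    have h : nhd D P i * nhd D P i ≤ nhd D P i := calc
      nhd D P i * nhd D P i = (P i * P i).map (mapInt D).toLinearMap *
          (fractionsSpan D * fractionsSpan D) := by
        rw [Submodule.map_mul, nhd]; ac_rfl
      _ ≤ _ := mul_le_mul' (Submodule.map_mono (hP.mul_self_le i)) (fractionsSpan_mul_self D)
    exact h (Submodule.mul_mem_mul hx hy)
  · exact exists_mul_mem_nhd hP x i

/-- The neighbourhoods of `0` in `A(T/s)`. -/
theorem hasBasis_nhds_zero [IsTopologicalRing A] :
    (𝓝 (0 : RatLoc D)).HasBasis (fun _ => True) fun n => (nhd D P n : Set (RatLoc D)) := by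
  have hB := nhd_ringSubgroupsBasis hP (D := D)
  have hbasis := hB.hasBasis_nhds_zero
  have hadm : IsAdmissible D hB.topology := by
    refine ⟨hB.nonarchimedean, ?_, ?_⟩
    · let := hB.topology
      have := hB.nonarchimedean
      refine continuous_of_continuousAt_zero (algebraMap A (RatLoc D)) ?_
      rw [ContinuousAt, map_zero, hbasis.tendsto_right_iff]
      intro n _
      filter_upwards [hP.mem_nhds n] with a ha using algebraMap_mem_nhd ha
    · intro U hU
      obtain ⟨n, -, hn⟩ := hbasis.mem_iff.1 hU
      exact ⟨_, hbasis.mem_of_mem (i := n) trivial, fun x hx y hy =>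
        hn (mul_mem_nhd hx (Submodule.subset_span hy))⟩
  refine ⟨fun U => ⟨fun hU => ?_, ?_⟩⟩
  · obtain ⟨G, hG⟩ := NonarchimedeanRing.is_nonarchimedean U hU
    obtain ⟨V, hV, H⟩ := isPowerBoundedSet_fractions D G (G.isOpen.mem_nhds G.zero_mem)
    have hV' : algebraMap A (RatLoc D) ⁻¹' V ∈ 𝓝 0 :=
      (continuous_algebraMap D).continuousAt.preimage_mem_nhds (by rwa [map_zero])
    obtain ⟨n, -, hn⟩ := hP.hasBasis.mem_iff.1 hV'
    refine ⟨n, trivial, fun x hx => hG ?_⟩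
    have hle : nhd D P n ≤ AddSubgroup.toIntSubmodule G.toAddSubgroup := by
      rw [nhd, Submodule.mul_le]
      rintro _ ⟨p, hp, rfl⟩ m hm
      induction hm using Submodule.span_induction with
      | mem m hm => exact H _ (hn hp) m hm
      | zero => rw [mul_zero]; exact zero_mem _
      | add x y _ _ hx hy => rw [mul_add]; exact add_mem hx hy
      | smul c x _ hx => rw [mul_smul_comm]; exact Submodule.smul_mem _ c hx
    exact hle hx
  -- Conversely, the topology with basis `P n · M` is admissible, hence coarser than the finest one.
  · rintro ⟨n, -, hn⟩
    exact Filter.mem_of_superset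
      (nhds_mono (topology_le D hadm) (hbasis.mem_of_mem (i := n) trivial)) hn

end RatLoc

end AdicFiltrations

/-! ### The plus-subring of `A(T/s)` and inclusions of rational subsets. -/

section PlusSubring

/-- The subring of power-bounded elements. -/
def powerBoundedSubring (R : Type u) [CommRing R] [TopologicalSpace R] [NonarchimedeanRing R] :
    Subring R :=
  have key : ∀ {a b c : R}, IsPowerBoundedSet {a} → IsPowerBoundedSet {b} →
      c ∈ Subring.closure ({a} ∪ {b} : Set R) → IsPowerBoundedSet {c} := fun ha hb hc =>
    isPowerBoundedSet_of_subset_subring (ha.union hb).isBoundedSet_subringClosure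
      (Set.singleton_subset_iff.2 hc)
  have h1 : IsPowerBoundedSet ({1} : Set R) :=
    (isBoundedSet_singleton (1 : R)).mono ((Submonoid.closure_le (S := ⊥)).2 (by simp))
  have hl : ∀ a b : R, a ∈ Subring.closure ({a} ∪ {b} : Set R) := fun _ _ =>
    Subring.subset_closure (Or.inl rfl)
  have hr : ∀ a b : R, b ∈ Subring.closure ({a} ∪ {b} : Set R) := fun _ _ =>
    Subring.subset_closure (Or.inr rfl)
  { carrier := {a | IsPowerBoundedSet {a}}
    mul_mem' := fun ha hb => key ha hb (mul_mem (hl _ _) (hr _ _))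
    one_mem' := h1
    add_mem' := fun ha hb => key ha hb (add_mem (hl _ _) (hr _ _))
    zero_mem' := key h1 h1 (zero_mem _)
    neg_mem' := fun ha => key ha ha (neg_mem (hl _ _)) }

variable {A : Type u} [CommRing A] [TopologicalSpace A]

theorem IsContinuousVal.comap {C : Type w} [CommRing C] [TopologicalSpace C] {f : A →+* C}
    (hf : Continuous f) {x : Spv C} (hx : IsContinuousVal x) : IsContinuousVal (comapSpv f x) :=
  (isContinuousVal_iff (represents_valClass _)).2 fun _ _ hs =>
    (hx.isOpen_lt (represents_valuation x) hs).preimage hf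

namespace RatLoc

variable (D : RationalDatum A) {P : ℕ → Submodule ℤ A} (hP : IsAdicFiltration P)

/-- The open subring of `A(T/s)` that, together with `A(T/s)`, has spectrum `R(T/s)`: the integral
closure of the subring generated by `A⁺` and the fractions `t/s`. -/
def plus (Aplus : Subring A) : Subring (RatLoc D) :=
  (integralClosure (Subring.closure (algebraMap A (RatLoc D) '' Aplus ∪ fractions D))
    (RatLoc D)).toSubring

variable {D} {Aplus : Subring A}

theorem mem_plus_of_mem {x : RatLoc D}
    (hx : x ∈ Subring.closure (algebraMap A (RatLoc D) '' Aplus ∪ fractions D)) :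
    x ∈ plus D Aplus :=
  (integralClosure (Subring.closure (algebraMap A (RatLoc D) '' Aplus ∪ fractions D))
    (RatLoc D)).algebraMap_mem ⟨x, hx⟩

theorem algebraMap_mem_plus {a : A} (ha : a ∈ Aplus) : algebraMap A (RatLoc D) a ∈ plus D Aplus :=
  mem_plus_of_mem (Subring.subset_closure (Or.inl ⟨a, ha, rfl⟩))

theorem fractions_subset_plus : fractions D ⊆ plus D Aplus := fun _ hx =>
  mem_plus_of_mem (Subring.subset_closure (Or.inr hx))

theorem fractionsSpan_le_plus :
    fractionsSpan D ≤ AddSubgroup.toIntSubmodule (plus D Aplus).toAddSubgroup :=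
  Submodule.span_le.2 ((Submonoid.closure_le (S := (plus D Aplus).toSubmonoid)).2
    fractions_subset_plus)

-- Continuous ring maps need not preserve boundedness. Here the explicit basis does it, since `P j ·
-- S ⊆ P i` gives `(P j · M) · S ⊆ P i · M`.
include hP in
theorem isBoundedSet_image [IsTopologicalRing A] {S : Set A} (hS : IsBoundedSet S) :
    IsBoundedSet (algebraMap A (RatLoc D) '' S) := fun U hU => by
  obtain ⟨i, -, hi⟩ := (hasBasis_nhds_zero hP).mem_iff.1 hU
  obtain ⟨V, hV, H⟩ := hS _ (hP.mem_nhds i)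
  obtain ⟨j, -, hj⟩ := hP.hasBasis.mem_iff.1 hV
  refine ⟨_, (hasBasis_nhds_zero hP).mem_of_mem (i := j) trivial, ?_⟩
  rintro x hx _ ⟨a, ha, rfl⟩
  refine hi ?_
  change x ∈ nhd D P j at hx
  induction hx using Submodule.mul_induction_on' with
  | mem_mul_mem p hp m hm =>
    obtain ⟨p, hp, rfl⟩ := hp
    rw [mul_right_comm]
    exact Submodule.mul_mem_mul ⟨p * a, H p (hj hp) a ha, map_mul (mapInt D) p a⟩ hm
  | add y _ z _ hy hz => rw [add_mul]; exact add_mem hy hz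

include hP in
theorem isPowerBoundedSet_algebraMap [IsTopologicalRing A] {S : Set A} (hS : IsPowerBoundedSet S) :
    IsPowerBoundedSet (algebraMap A (RatLoc D) '' S) := by
  refine (isBoundedSet_image hP hS).mono fun x hx => ?_
  have := MonoidHom.map_mclosure (algebraMap A (RatLoc D) : A →* RatLoc D) S
  change Submonoid.map _ (Submonoid.closure S) =
    Submonoid.closure (algebraMap A (RatLoc D) '' S) at this
  rw [← this] at hx
  exact hx

include hP in
theorem plus_le_powerBoundedSubring [IsTopologicalRing A]
    (hplus : ∀ a ∈ Aplus, IsPowerBoundedSet ({a} : Set A)) :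
    plus D Aplus ≤ powerBoundedSubring (RatLoc D) := by
  have h0 : Subring.closure (algebraMap A (RatLoc D) '' Aplus ∪ fractions D) ≤
      powerBoundedSubring (RatLoc D) := by
    rw [Subring.closure_le]
    rintro x (⟨a, ha, rfl⟩ | hx)
    · have := isPowerBoundedSet_algebraMap hP (D := D) (hplus a ha)
      rwa [Set.image_singleton] at this
    · exact (isPowerBoundedSet_fractions D).mono (Set.singleton_subset_iff.2 hx)
  exact fun x hx => isPowerBoundedSet_singleton_of_isIntegral' h0 hx

/-- Makes the valuation criteria available for `A(T/s)`. The ideal `J` is generated by the images of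
generators of an ideal of definition; its topological nilpotence is what later allows geometric
series. -/
theorem exists_isDefiningPair [IsTopologicalRing A] (hP : IsAdicFiltration P)
    (hplus : ∀ a ∈ Aplus, IsPowerBoundedSet ({a} : Set A)) (hPplus : (P 1 : Set A) ⊆ Aplus) :
    ∃ J : Ideal (plus D Aplus), IsDefiningPair (plus D Aplus) J ∧
      ∀ j ∈ J, Filter.Tendsto (fun n : ℕ => (j : RatLoc D) ^ n) Filter.atTop (𝓝 0) := by
  set W := plus D Aplus with hW
  let Wz : Submodule ℤ (RatLoc D) := AddSubgroup.toIntSubmodule W.toAddSubgroup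
  obtain ⟨F, hF⟩ := hP.exists_span_pow
  have hF1 : Submodule.span ℤ (F : Set A) ≤ P 1 := by simpa using (hF 0).1
  let Fz : Submodule ℤ (RatLoc D) := (Submodule.span ℤ (F : Set A)).map (mapInt D).toLinearMap
  have hFpow : ∀ n, Fz ^ n = (Submodule.span ℤ (F : Set A) ^ n).map (mapInt D).toLinearMap :=
    fun n => (Submodule.map_pow _ (mapInt D) n).symm
  have hfin : {w : W | (w : RatLoc D) ∈ algebraMap A (RatLoc D) '' F}.Finite :=
    (F.finite_toSet.image _).preimage Subtype.val_injective.injOn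
  let S : Finset W := hfin.toFinset
  have hS : ∀ w : W, w ∈ S ↔ ∃ f ∈ F, algebraMap A (RatLoc D) f = w := fun w => by simp [S]
  let J : Ideal W := Ideal.span (S : Set W)
  let Jz : ℕ → Submodule ℤ (RatLoc D) := fun n =>
    AddSubgroup.toIntSubmodule (((J ^ n).toAddSubgroup).map (W.subtype : W →+ RatLoc D))
  have hJz : ∀ n x, x ∈ Jz n ↔ ∃ y ∈ J ^ n, (y : RatLoc D) = x := fun n x => Iff.rfl
  have hFJ : Fz ≤ Jz 1 := by
    refine (Submodule.map_span_le _ _ _).2 fun f hf => ?_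
    refine ⟨⟨algebraMap A (RatLoc D) f,
      algebraMap_mem_plus (hPplus (hF1 (Submodule.subset_span hf)))⟩, ?_, rfl⟩
    rw [pow_one]
    exact Ideal.subset_span ((hS _).2 ⟨f, hf, rfl⟩)
  have hFJn : ∀ n, Fz ^ n ≤ Jz n := by
    intro n
    induction n with
    | zero =>
      rw [pow_zero, Submodule.one_eq_span, Submodule.span_le, Set.singleton_subset_iff]
      exact ⟨1, by simp, rfl⟩
    | succ n ih =>
      rw [pow_succ, Submodule.mul_le]
      intro x hx y hy
      obtain ⟨x', hx', rfl⟩ := (hJz _ _).1 (ih hx)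
      obtain ⟨y', hy', rfl⟩ := (hJz _ _).1 (hFJ hy)
      rw [pow_one] at hy'
      exact (hJz _ _).2 ⟨x' * y', by rw [pow_succ]; exact Ideal.mul_mem_mul hx' hy', rfl⟩
  have hJW : ∀ n, Jz n * Wz ≤ Jz n := by
    intro n
    rw [Submodule.mul_le]
    rintro _ ⟨x, hx, rfl⟩ w hw
    exact ⟨x * ⟨w, hw⟩, Ideal.mul_mem_right _ _ hx, rfl⟩
  have hmem : ∀ n : ℕ, (Subtype.val '' ((J ^ n : Ideal W) : Set W) : Set (RatLoc D)) ∈ 𝓝 0 := by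
    intro n
    -- `P (n + 1 + 1)` lies in `F ^ (n + 1) · P 1`: the first factor goes into `J ^ (n + 1)`, and `P
    -- 1 ⊆ A⁺` goes into `W`.
    refine Filter.mem_of_superset ((hasBasis_nhds_zero hP).mem_of_mem (i := n + 1 + 1) trivial) ?_
    have h1 : (P 1).map (mapInt D).toLinearMap ≤ Wz := by
      rintro _ ⟨a, ha, rfl⟩
      exact algebraMap_mem_plus (hPplus ha)
    have h2 : nhd D P (n + 1 + 1) ≤ Jz (n + 1) := calc
      nhd D P (n + 1 + 1) ≤
          (Submodule.span ℤ (F : Set A) ^ (n + 1) * P 1).map (mapInt D).toLinearMap *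
            fractionsSpan D := mul_le_mul_left (Submodule.map_mono ((hF n).2 1)) _
      _ = Fz ^ (n + 1) * (P 1).map (mapInt D).toLinearMap * fractionsSpan D := by
          rw [Submodule.map_mul, hFpow]
      _ ≤ Jz (n + 1) * Wz * Wz :=
          mul_le_mul' (mul_le_mul' (hFJn _) h1) fractionsSpan_le_plus
      _ ≤ Jz (n + 1) := (mul_le_mul_left (hJW _) _).trans (hJW _)
    intro x hx
    obtain ⟨y, hy, rfl⟩ := h2 hx
    exact ⟨y, Ideal.pow_le_pow_right n.le_succ hy, rfl⟩
  have hnil : ∀ j ∈ J, Filter.Tendsto (fun n : ℕ => (j : RatLoc D) ^ n) Filter.atTop (𝓝 0) := by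
    intro j hj
    -- `W` is only known to consist of power-bounded elements. The finitely many coefficients of `j`
    -- generate a bounded subring `B`, and `j ^ n ∈ F ^ n · B` tends to `0`.
    obtain ⟨f, -, hf⟩ := Submodule.mem_span_finset.1 hj
    let G : Set (RatLoc D) := (fun a : W => ((f a : W) : RatLoc D)) '' S
    let B : Subring (RatLoc D) := Subring.closure G
    have hB : IsBoundedSet (B : Set (RatLoc D)) := by
      refine (isPowerBoundedSet_of_finite (S.finite_toSet.image _) ?_).isBoundedSet_subringClosure
      rintro _ ⟨a, -, rfl⟩
      exact plus_le_powerBoundedSubring hP hplus (f a).2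
    let Bz : Submodule ℤ (RatLoc D) := AddSubgroup.toIntSubmodule B.toAddSubgroup
    have hjn : ∀ n, (j : RatLoc D) ^ n ∈ Fz ^ n * Bz := by
      have hj1 : (j : RatLoc D) ∈ Fz * Bz := by
        rw [← hf, AddSubmonoidClass.coe_finsetSum]
        refine sum_mem fun a ha => ?_
        obtain ⟨g, hg, hga⟩ := (hS a).1 ha
        rw [smul_eq_mul, mul_comm (f a) a, Subring.coe_mul]
        have hfa : ((f a : W) : RatLoc D) ∈ B := Subring.subset_closure ⟨a, ha, rfl⟩
        have hgF : (a : RatLoc D) ∈ Fz := ⟨g, Submodule.subset_span hg, hga⟩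
        exact Submodule.mul_mem_mul hgF hfa
      have hBB : Bz * Bz ≤ Bz := Submodule.mul_le.2 fun x hx y hy => B.mul_mem hx hy
      intro n
      induction n with
      | zero =>
        rw [pow_zero, pow_zero, one_mul]
        exact B.one_mem
      | succ n ih =>
        have := Submodule.mul_mem_mul ih hj1
        rw [pow_succ, pow_succ]
        refine (?_ : Fz ^ n * Bz * (Fz * Bz) ≤ Fz ^ n * Fz * Bz) this
        rw [mul_mul_mul_comm]
        exact mul_le_mul_right hBB _
    rw [(hasBasis_nhds_zero hP).tendsto_right_iff]
    intro i _
    obtain ⟨V, hV, H⟩ := hB _ ((hasBasis_nhds_zero hP).mem_of_mem (i := i) trivial)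
    obtain ⟨k, -, hk⟩ := (hasBasis_nhds_zero hP).mem_iff.1 hV
    filter_upwards [Filter.eventually_ge_atTop (k + 1)] with n hn
    have hle : Fz ^ n * Bz ≤ nhd D P i := by
      rw [Submodule.mul_le]
      intro x hx y hy
      refine H x (hk ?_) y hy
      rw [hFpow] at hx
      obtain ⟨p, hp, rfl⟩ := hx
      obtain ⟨m, rfl⟩ := Nat.exists_eq_add_of_le' (Nat.one_le_of_lt hn)
      exact algebraMap_mem_nhd (hP.antitone (Nat.le_of_succ_le hn) ((hF m).1 hp))
    exact hle (hjn n)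
  refine ⟨J, ⟨⟨S, rfl⟩, hmem, fun c j hj => ?_⟩, hnil⟩
  have hWn : (W : Set (RatLoc D)) ∈ 𝓝 0 :=
    Filter.mem_of_superset (hmem 0) (by rintro _ ⟨w, -, rfl⟩; exact w.2)
  have ht : Filter.Tendsto (fun n : ℕ => c * (j : RatLoc D) ^ n) Filter.atTop (𝓝 0) := by
    simpa using (hnil j hj).const_mul c
  exact (ht.eventually hWn).exists

end RatLoc

open RatLoc

/-- The valuations on `A(T/s)` that are continuous and bounded by `1` on the plus-subring restrict
to points of `R(T/s)`. -/
theorem exists_mem_rationalSubset {Aplus : Subring A} (D : RationalDatum A) {x : Spv (RatLoc D)}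
    (hx : IsContinuousVal x) (hW : ∀ w ∈ plus D Aplus, x.vle w 1) :
    ∃ y ∈ rationalSubset Aplus D,
      ∀ a b, y.1.vle a b ↔ x.vle (algebraMap A (RatLoc D) a) (algebraMap A (RatLoc D) b) := by
  set φ := algebraMap A (RatLoc D) with hφ
  have hv := represents_valuation x
  set v := (letI : ValuativeRel (RatLoc D) := x; ValuativeRel.valuation (RatLoc D)) with hvdef
  have hplus : ∀ a ∈ Aplus, (comapSpv φ x).vle a 1 := fun a ha => by
    rw [comapSpv_vle, map_one]
    exact hW _ (algebraMap_mem_plus ha)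
  refine ⟨⟨comapSpv φ x, hx.comap (continuous_algebraMap D), hplus⟩, ⟨?_, fun t ht => ?_⟩,
    comapSpv_vle φ x⟩
  · change ¬ (comapSpv φ x).vle D.s 0
    rw [comapSpv_vle, map_zero, hv.eq_zero_iff]
    exact ((isUnit_algebraMap_s D).map v).ne_zero
  · change (comapSpv φ x).vle t D.s
    rw [comapSpv_vle, hv]
    have h1 := hW _ (fractions_subset_plus (Aplus := Aplus) ⟨t, ht, rfl⟩)
    rw [hv, map_one] at h1
    have h2 : φ t = φ t * IsLocalization.Away.invSelf D.s * φ D.s := by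
      rw [mul_assoc, mul_comm _ (φ D.s), IsLocalization.Away.mul_invSelf, mul_one]
    rw [h2, map_mul]
    exact (mul_le_mul_left h1 _).trans_eq (one_mul _)

/-- If `R(T'/s') ⊆ R(T/s)`, then `s` is invertible in `A⟨T'/s'⟩` and the fractions `t/s` are
power-bounded there. -/
theorem exists_unit_isPowerBoundedSet {Aplus : Subring A} (hA : IsHuberPair Aplus)
    {D D' : RationalDatum A} (h : rationalOpen Aplus D' ≤ rationalOpen Aplus D) :
    ∃ b : (RatCompl D')ˣ, (b : RatCompl D') = toRatCompl D' D.s ∧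
      IsPowerBoundedSet
        ((fun t : A => toRatCompl D' t * ((b⁻¹ : (RatCompl D')ˣ) : RatCompl D')) ''
          (D.T : Set A)) := by
  have := hA.isHuberRing.1
  obtain ⟨P, hP, hPplus⟩ := hA.isHuberRing.exists_isAdicFiltration
    (hA.isOpen.mem_nhds Aplus.zero_mem)
  obtain ⟨J, hJ, hnil⟩ := exists_isDefiningPair (D := D') hP hA.isPowerBounded hPplus
  set φ := algebraMap A (RatLoc D') with hφ
  let ι : RatLoc D' →+* RatCompl D' := UniformSpace.Completion.coeRingHom
  have hs : ∀ x : Spv (RatLoc D'), IsContinuousVal x → (∀ w ∈ plus D' Aplus, x.vle w 1) →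
      ¬ x.vle (φ D.s) 0 := by
    intro x hx hW
    obtain ⟨y, hy, hyx⟩ := exists_mem_rationalSubset D' hx hW
    have := (h hy).1
    rwa [hyx, map_zero] at this
  have ht : ∀ t ∈ D.T, ∀ x : Spv (RatLoc D'), IsContinuousVal x →
      (∀ w ∈ plus D' Aplus, x.vle w 1) → x.vle (φ t) (φ D.s) := by
    intro t ht x hx hW
    obtain ⟨y, hy, hyx⟩ := exists_mem_rationalSubset D' hx hW
    exact (hyx _ _).1 ((h hy).2 t ht)
  -- Before completion `s` is only known to be a unit modulo `J`.
  obtain ⟨c, j, hj, hcj⟩ := hJ.exists_mul_add_eq_one hs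
  have hint : ∀ t ∈ D.T, IsPowerBoundedSet {φ t * c} := by
    intro t htT
    -- On every relevant valuation `|t c| ≤ |s c| = |1 - j| ≤ 1`, so `t c` is integral over the
    -- plus-subring.
    refine isPowerBoundedSet_singleton_of_isIntegral'
      (plus_le_powerBoundedSubring hP hA.isPowerBounded) (hJ.isIntegral fun x hx hW => ?_)
    have h1 : x.vle (φ t * c) (φ D.s * c) := x.mul_vle_mul_left (ht t htT x hx hW) c
    refine x.vle_trans h1 (hW _ ?_)
    rw [eq_sub_of_add_eq hcj]
    exact sub_mem (one_mem _) j.2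
  let G : Set (RatLoc D') := (fun t => φ t * c) '' (D.T : Set A) ∪ {(j : RatLoc D')}
  have hG : IsPowerBoundedSet G :=
    (isPowerBoundedSet_of_finite (D.T.finite_toSet.image _) (by
      rintro _ ⟨t, ht, rfl⟩
      exact hint t ht)).union (plus_le_powerBoundedSubring hP hA.isPowerBounded j.2)
  -- One bounded subring contains every `t/s = t c · (1 - j)⁻¹`; it is taken closed so that it
  -- contains the sum of the geometric series.
  let Q : Subring (RatCompl D') := (Subring.closure (ι '' G)).topologicalClosure
  have hQ : IsBoundedSet (Q : Set (RatCompl D')) :=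
    hG.completion.isBoundedSet_subringClosure.closure
  have hGQ : ∀ g ∈ G, ι g ∈ Q := fun g hg =>
    Subring.le_topologicalClosure _ (Subring.subset_closure ⟨g, hg, rfl⟩)
  have hjn : Filter.Tendsto (fun n : ℕ => ι j ^ n) Filter.atTop (𝓝 0) := by
    have h0 : Filter.Tendsto ι (𝓝 0) (𝓝 0) := by
      have := (UniformSpace.Completion.continuous_coe (RatLoc D')).tendsto 0
      rwa [UniformSpace.Completion.coe_zero] at this
    simpa only [Function.comp_def, map_pow] using h0.comp (hnil j hj)
  obtain ⟨u, huQ, hu⟩ := exists_mul_one_sub_eq_one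
    (Subring.isClosed_topologicalClosure _ : IsClosed (Q : Set (RatCompl D')))
    (hGQ j (Or.inr rfl)) hjn
  have hinv : toRatCompl D' D.s * (ι c * u) = 1 := by
    have : toRatCompl D' D.s = ι (φ D.s) := rfl
    rw [this, ← mul_assoc, ← map_mul, eq_sub_of_add_eq hcj, map_sub, map_one, hu]
  refine ⟨⟨toRatCompl D' D.s, ι c * u, hinv, by rw [mul_comm]; exact hinv⟩, rfl,
    isPowerBoundedSet_of_subset_subring hQ ?_⟩
  rintro _ ⟨t, ht, rfl⟩
  change ι (φ t) * (ι c * u) ∈ Q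
  rw [← mul_assoc, ← map_mul]
  exact Q.mul_mem (hGQ _ (Or.inl ⟨t, ht, rfl⟩)) huQ

end PlusSubring

/-! ### Basis of rational subsets, transition maps and sections. -/

section StructurePresheaf

variable {A : Type u} [CommRing A] [TopologicalSpace A]

section Basis

/-- Finite generation of the ideal of definition gives `P (m + 1 + n) ⊆ P (m + 1) · P n`, which lies
in `I * J` once `P m ⊆ I` and `P n ⊆ J`. -/
theorem IsHuberRing.isOpen_mul (h : IsHuberRing A) {I J : Ideal A} (hI : IsOpen (I : Set A))
    (hJ : IsOpen (J : Set A)) : IsOpen ((I * J : Ideal A) : Set A) := by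
  have := h.1
  obtain ⟨P, hP, -⟩ := h.exists_isAdicFiltration Filter.univ_mem
  obtain ⟨m, -, hm⟩ := hP.hasBasis.mem_iff.1 (hI.mem_nhds I.zero_mem)
  obtain ⟨n, -, hn⟩ := hP.hasBasis.mem_iff.1 (hJ.mem_nhds J.zero_mem)
  obtain ⟨F, hF⟩ := hP.exists_span_pow
  refine (I * J).toAddSubgroup.isOpen_of_mem_nhds (g := 0)
    (Filter.mem_of_superset (hP.mem_nhds (m + 1 + n)) fun x hx => ?_)
  have hx' := ((hF m).2 n).trans (mul_le_mul_left (hF m).1 _) hx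
  refine Submodule.mul_induction_on hx' (fun a ha b hb => ?_) fun _ _ => add_mem
  exact Ideal.mul_mem_mul (hm (hP.antitone m.le_succ ha)) (hn hb)

open scoped Classical Pointwise in
/-- The datum of the intersection of two rational subsets. -/
def RationalDatum.inter (h : IsHuberRing A) (D D' : RationalDatum A) : RationalDatum A where
  s := D.s * D'.s
  T := insert D.s D.T * insert D'.s D'.T
  isOpen_span := by
    have := h.1
    -- Adding the denominators to `T` and `T'` changes neither subset and keeps the ideals open. The
    -- products `t * s'` and `s * t'` then recover the two separate conditions.
    have hmono : ∀ E : RationalDatum A,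
        IsOpen (Ideal.span ((insert E.s E.T : Finset A) : Set A) : Set A) := fun E =>
      AddSubgroup.isOpen_mono (H₁ := (Ideal.span (E.T : Set A)).toAddSubgroup)
        (H₂ := (Ideal.span ((insert E.s E.T : Finset A) : Set A)).toAddSubgroup)
        (Ideal.span_mono (by simp)) E.isOpen_span
    rw [Finset.coe_mul, ← Ideal.span_mul_span']
    exact h.isOpen_mul (hmono D) (hmono D')

theorem rationalSubset_inter (Aplus : Subring A) (h : IsHuberRing A) (D D' : RationalDatum A) :
    rationalSubset Aplus (D.inter h D') = rationalSubset Aplus D ∩ rationalSubset Aplus D' := by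
  classical
  ext x
  have hv := represents_valuation x.1
  set v := (letI : ValuativeRel A := x.1; ValuativeRel.valuation A)
  simp only [rationalSubset, Set.mem_inter_iff, Set.mem_ofPred_eq, hv _ _, map_zero, le_zero_iff,
    RationalDatum.inter, map_mul, mul_eq_zero, not_or]
  constructor
  · rintro ⟨⟨hs, hs'⟩, hT⟩
    refine ⟨⟨hs, fun t ht => ?_⟩, ⟨hs', fun t ht => ?_⟩⟩
    · have := hT _ (Finset.mul_mem_mul (Finset.mem_insert_of_mem ht) (Finset.mem_insert_self D'.s _))
      rw [map_mul] at this
      exact le_of_mul_le_mul_right this (zero_lt_iff.2 hs')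
    · have := hT _ (Finset.mul_mem_mul (Finset.mem_insert_self D.s _) (Finset.mem_insert_of_mem ht))
      rw [map_mul] at this
      exact le_of_mul_le_mul_left this (zero_lt_iff.2 hs)
  · rintro ⟨⟨hs, hT⟩, ⟨hs', hT'⟩⟩
    refine ⟨⟨hs, hs'⟩, fun t ht => ?_⟩
    obtain ⟨a, ha, b, hb, rfl⟩ := Finset.mem_mul.1 ht
    rw [map_mul]
    refine mul_le_mul' ?_ ?_
    · rcases Finset.mem_insert.1 ha with rfl | ha
      exacts [le_rfl, hT a ha]
    · rcases Finset.mem_insert.1 hb with rfl | hb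
      exacts [le_rfl, hT' b hb]

theorem isTopologicalBasis_rationalSubset (Aplus : Subring A) (h : IsHuberRing A) :
    IsTopologicalBasis (Set.range (rationalSubset Aplus)) where
  exists_subset_inter := by
    rintro _ ⟨D, rfl⟩ _ ⟨D', rfl⟩ x hx
    rw [← rationalSubset_inter Aplus h] at hx ⊢
    exact ⟨_, ⟨_, rfl⟩, hx, subset_rfl⟩
  sUnion_eq := by
    refine Set.eq_univ_of_forall fun x => Set.mem_sUnion.2 ⟨_, ⟨⟨1, {1}, by simp⟩, rfl⟩, ?_⟩
    exact ⟨x.1.not_vle_one_zero, by simp⟩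
  eq_generateFrom := rfl

theorem exists_rationalOpen_le {Aplus : Subring A} (h : IsHuberRing A) {U : Opens (Spa Aplus)}
    {x : Spa Aplus} (hx : x ∈ U) : ∃ D, x ∈ rationalOpen Aplus D ∧ rationalOpen Aplus D ≤ U := by
  obtain ⟨_, ⟨D, rfl⟩, hxD, hDU⟩ :=
    (isTopologicalBasis_rationalSubset Aplus h).exists_subset_of_mem_open hx U.isOpen
  exact ⟨D, hxD, hDU⟩

end Basis

section Completion

theorem continuous_toRatCompl (D : RationalDatum A) : Continuous (toRatCompl D) :=
  (UniformSpace.Completion.continuous_coe _).comp (RatLoc.continuous_algebraMap D)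

theorem ratCompl_ringHom_ext (D : RationalDatum A) {B : Type v} [CommRing B] [TopologicalSpace B]
    [T2Space B] {g g' : RatCompl D →+* B} (hg : Continuous g) (hg' : Continuous g')
    (h : g.comp (toRatCompl D) = g'.comp (toRatCompl D)) : g = g' := by
  have h' : g.comp UniformSpace.Completion.coeRingHom =
      g'.comp (UniformSpace.Completion.coeRingHom : RatLoc D →+* RatCompl D) :=
    RatLoc.ringHom_ext D h
  exact DFunLike.coe_injective (UniformSpace.Completion.ext hg hg' fun a =>
    DFunLike.congr_fun h' a)

/-- The universal property of `A⟨T/s⟩`. -/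
theorem existsUnique_ratCompl_lift (D : RationalDatum A) {B : Type v} [CommRing B] [UniformSpace B]
    [IsUniformAddGroup B] [NonarchimedeanRing B] [CompleteSpace B] [T2Space B]
    (f : A →+* B) (b : Bˣ) (hf : Continuous f) (hb : (b : B) = f D.s)
    (hpb : IsPowerBoundedSet ((fun t : A => f t * ((b⁻¹ : Bˣ) : B)) '' (D.T : Set A))) :
    ∃! g : RatCompl D →+* B, Continuous g ∧ g.comp (toRatCompl D) = f := by
  obtain ⟨g, ⟨hg, hgf⟩, -⟩ := RatLoc.existsUnique_lift D f b hf hb hpb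
  refine ⟨UniformSpace.Completion.extensionHom g hg,
    ⟨UniformSpace.Completion.continuous_extension, ?_⟩, fun g' hg' => ?_⟩
  · ext a
    rw [← hgf]
    exact UniformSpace.Completion.extensionHom_coe g hg _
  · refine ratCompl_ringHom_ext D hg'.1 UniformSpace.Completion.continuous_extension ?_
    rw [hg'.2]
    ext a
    rw [← hgf]
    exact (UniformSpace.Completion.extensionHom_coe g hg _).symm

theorem existsUnique_isCanonicalMap {Aplus : Subring A} (hA : IsHuberPair Aplus)
    {D D' : RationalDatum A} (h : rationalOpen Aplus D' ≤ rationalOpen Aplus D) :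
    ∃! ρ : RatCompl D →+* RatCompl D', IsCanonicalMap ρ := by
  obtain ⟨b, hb, hpb⟩ := exists_unit_isPowerBoundedSet hA h
  exact existsUnique_ratCompl_lift D (toRatCompl D') b (continuous_toRatCompl D') hb hpb

end Completion

section Presheaf

variable {Aplus : Subring A}

theorem isClosed_sections (U : Opens (Spa Aplus)) :
    IsClosed (sections Aplus U :
      Set (∀ D : {D : RationalDatum A // rationalOpen Aplus D ≤ U}, RatCompl D.1)) := by
  refine isClosed_of_closure_subset fun f hf => ?_
  intro D D' h ρ hρ
  have hc : Continuous fun f : (∀ D : {D : RationalDatum A // rationalOpen Aplus D ≤ U},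
      RatCompl D.1) => ρ (f D) := hρ.1.comp (continuous_apply D)
  have hc' : Continuous fun f : (∀ D : {D : RationalDatum A // rationalOpen Aplus D ≤ U},
      RatCompl D.1) => f D' := continuous_apply D'
  have hcl := isClosed_eq hc hc'
  have hsub : (sections Aplus U : Set (∀ D : {D : RationalDatum A // rationalOpen Aplus D ≤ U},
      RatCompl D.1)) ⊆ {f | ρ (f D) = f D'} := fun g hg => hg D D' h ρ hρ
  exact closure_minimal hsub hcl hf

theorem isCompleteRing_sections (U : Opens (Spa Aplus)) : IsCompleteRing (sections Aplus U) := by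
  have h1 : CompleteSpace (sections Aplus U) :=
    completeSpace_coe_iff_isComplete.2 (isClosed_sections U).isComplete
  have h2 : IsUniformAddGroup (sections Aplus U) :=
    inferInstanceAs (IsUniformAddGroup (sections Aplus U).toAddSubgroup)
  -- `IsCompleteRing` refers to the uniformity of the additive group, which has to be matched with
  -- the subspace uniformity.
  have h3 : IsTopologicalAddGroup.rightUniformSpace (sections Aplus U) =
      (inferInstance : UniformSpace (sections Aplus U)) :=
    IsUniformAddGroup.rightUniformSpace_eq
  unfold IsCompleteRing
  convert! h1

variable (hA : IsHuberPair Aplus)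

include hA

/-- The canonical map `A⟨T/s⟩ → A⟨T'/s'⟩` for `R(T'/s') ⊆ R(T/s)`. -/
def canonicalMap {D D' : RationalDatum A} (h : rationalOpen Aplus D' ≤ rationalOpen Aplus D) :
    RatCompl D →+* RatCompl D' :=
  (existsUnique_isCanonicalMap hA h).exists.choose

theorem isCanonicalMap_canonicalMap {D D' : RationalDatum A}
    (h : rationalOpen Aplus D' ≤ rationalOpen Aplus D) : IsCanonicalMap (canonicalMap hA h) :=
  (existsUnique_isCanonicalMap hA h).exists.choose_spec

theorem sections_apply_eq {U : Opens (Spa Aplus)} (f : sections Aplus U)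
    {D D' : {D : RationalDatum A // rationalOpen Aplus D ≤ U}}
    (h : rationalOpen Aplus D'.1 ≤ rationalOpen Aplus D.1) :
    f.1 D' = canonicalMap hA h (f.1 D) :=
  (f.2 D D' h _ (isCanonicalMap_canonicalMap hA h)).symm

/-- The section over `R(T/s)` defined by an element of `A⟨T/s⟩`. -/
def ofValue (D : RationalDatum A) (y : RatCompl D) : sections Aplus (rationalOpen Aplus D) :=
  ⟨fun E => canonicalMap hA E.2 y, fun E E' h ρ hρ => by
    have hE := isCanonicalMap_canonicalMap hA E.2
    have hE' := isCanonicalMap_canonicalMap hA E'.2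
    have : ρ.comp (canonicalMap hA E.2) = canonicalMap hA E'.2 :=
      ratCompl_ringHom_ext D (hρ.1.comp hE.1) hE'.1 (by
        rw [RingHom.comp_assoc, hE.2, hρ.2, hE'.2])
    exact DFunLike.congr_fun this y⟩

theorem continuous_ofValue (D : RationalDatum A) :
    Continuous (ofValue hA D) :=
  Continuous.subtype_mk (continuous_pi fun E => (isCanonicalMap_canonicalMap hA E.2).1) _

theorem toValue_ofValue (D : RationalDatum A) (y : RatCompl D) :
    toValue Aplus D (ofValue hA D y) = y := by
  have h : canonicalMap hA (le_refl (rationalOpen Aplus D)) = RingHom.id _ :=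
    (existsUnique_isCanonicalMap hA le_rfl).unique (isCanonicalMap_canonicalMap hA _)
      ⟨continuous_id, RingHom.id_comp _⟩
  exact DFunLike.congr_fun h y

theorem ofValue_toValue (D : RationalDatum A) (f : sections Aplus (rationalOpen Aplus D)) :
    ofValue hA D (toValue Aplus D f) = f :=
  Subtype.ext (funext fun E => (sections_apply_eq hA f (D := ⟨D, le_rfl⟩) (D' := E) E.2).symm)

omit hA in
theorem continuous_toValue (D : RationalDatum A) : Continuous (toValue Aplus D) := by
  have h : Continuous
      fun f : ∀ E : {E : RationalDatum A // rationalOpen Aplus E ≤ rationalOpen Aplus D},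
        RatCompl E.1 => f ⟨D, le_rfl⟩ := continuous_apply _
  exact h.comp continuous_subtype_val

/-- The projection `𝒪(R(T/s)) → A⟨T/s⟩` as a homeomorphism. -/
def toValueHomeomorph (D : RationalDatum A) :
    sections Aplus (rationalOpen Aplus D) ≃ₜ RatCompl D where
  toFun := toValue Aplus D
  invFun := ofValue hA D
  left_inv := ofValue_toValue hA D
  right_inv := toValue_ofValue hA D
  continuous_toFun := continuous_toValue D
  continuous_invFun := continuous_ofValue hA D

theorem isHomeomorph_toValue (D : RationalDatum A) : IsHomeomorph (toValue Aplus D) :=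
  (toValueHomeomorph hA D).isHomeomorph

end Presheaf

end StructurePresheaf

/-! ### The completed residue field of a valuation. -/

section CompletedField

variable {R : Type u} [CommRing R] {Γ₀ : Type v} [LinearOrderedCommGroupWithZero Γ₀]

theorem fracValuation_algebraMap (v : Valuation R Γ₀) (a : R) :
    fracValuation v (algebraMap (R ⧸ v.supp) (FractionRing (R ⧸ v.supp))
      (Ideal.Quotient.mk v.supp a)) = v a :=
  (Valuation.extendToLocalization_apply_map_apply _ _ _ _).trans rfl

theorem completedValuation_toCompletedField (v : Valuation R Γ₀) (a : R) :
    completedValuation v (toCompletedField v a) = v a := by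
  refine (Valued.extensionValuation_apply_coe (K := WithVal (fracValuation v)) _).trans ?_
  exact fracValuation_algebraMap v a

/-- The values of the completed valuation are quotients of values of the original one. -/
theorem exists_completedValuation_mul_eq (v : Valuation R Γ₀) (y : CompletedField v) :
    ∃ a b : R, v b ≠ 0 ∧ completedValuation v y * v b = v a := by
  obtain ⟨k, hk⟩ := Valued.exists_coe_eq_v (K := WithVal (fracValuation v)) y
  obtain ⟨p, q, hq, hpq⟩ := IsFractionRing.div_surjective (A := R ⧸ v.supp) k.ofVal
  obtain ⟨a, rfl⟩ := Ideal.Quotient.mk_surjective p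
  obtain ⟨b, rfl⟩ := Ideal.Quotient.mk_surjective q
  have hb : v b ≠ 0 := by
    intro h
    refine nonZeroDivisors.ne_zero hq (Ideal.Quotient.eq_zero_iff_mem.2 ?_)
    exact (v.mem_supp_iff b).2 h
  refine ⟨a, b, hb, ?_⟩
  have h1 : completedValuation v y = fracValuation v k.ofVal := hk
  rw [h1, ← hpq, map_div₀, fracValuation_algebraMap, fracValuation_algebraMap, div_mul_cancel₀ _ hb]

/-- The threshold `v b / v a` is the value of an element of the field, so the set is a ball of the
valued field. -/
theorem isClopen_completedValuation_lt (v : Valuation R Γ₀) {a b : R} (ha : v a ≠ 0) :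
    IsClopen {y : CompletedField v | completedValuation v y * v a < v b} := by
  have h := Valued.isClopen_ball (CompletedField v)
    (Valued.v.restrict (toCompletedField v b / toCompletedField v a))
  convert! h using 2
  ext y
  rw [Valuation.restrict_lt_iff]
  change _ ↔ completedValuation v y < completedValuation v _
  rw [map_div₀, completedValuation_toCompletedField, completedValuation_toCompletedField,
    lt_div_iff₀ (zero_lt_iff.2 ha)]

/-- Completion creates no new values, so pairs of elements of `R` already give all radii. -/
theorem hasBasis_nhds_zero_completedField (v : Valuation R Γ₀) :
    (𝓝 (0 : CompletedField v)).HasBasis (fun p : R × R => v p.1 ≠ 0 ∧ v p.2 ≠ 0)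
      fun p => {y | completedValuation v y * v p.1 < v p.2} := by
  refine ⟨fun U => ⟨fun hU => ?_, ?_⟩⟩
  · obtain ⟨γ, hγ⟩ := (Valued.mem_nhds_zero (R := CompletedField v) (Γ₀ := Γ₀)).1 hU
    obtain ⟨r, s, hr, hs, hrs⟩ := Valuation.restrict_exists_div_eq
      (Valued.v : Valuation (CompletedField v) Γ₀) γ
    obtain ⟨a, b, hb, hab⟩ := exists_completedValuation_mul_eq v (r / s)
    have hrs0 : completedValuation v (r / s) ≠ 0 := by
      rw [map_div₀]
      exact div_ne_zero hr.ne' hs.ne'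
    have ha : v a ≠ 0 := by
      rw [← hab]
      exact mul_ne_zero hrs0 hb
    refine ⟨(b, a), ⟨hb, ha⟩, fun y hy => hγ ?_⟩
    rw [Set.mem_ofPred_eq, ← hrs, ← map_div₀, Valuation.restrict_lt_iff]
    rw [Set.mem_ofPred_eq, ← hab] at hy
    exact lt_of_mul_lt_mul_right hy zero_le
  · rintro ⟨⟨a, b⟩, ⟨ha, hb⟩, hU⟩
    refine Filter.mem_of_superset ((isClopen_completedValuation_lt v ha).isOpen.mem_nhds ?_) hU
    simpa [zero_lt_iff] using hb

instance (v : Valuation R Γ₀) : NonarchimedeanRing (CompletedField v) where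
  is_nonarchimedean U hU := by
    obtain ⟨⟨a, b⟩, ⟨ha, hb⟩, hU⟩ := (hasBasis_nhds_zero_completedField v).mem_iff.1 hU
    let G : AddSubgroup (CompletedField v) :=
      { carrier := {y | completedValuation v y * v a < v b}
        zero_mem' := by simpa [zero_lt_iff] using hb
        add_mem' := by
          intro x y hx hy
          refine lt_of_le_of_lt (mul_le_mul_left ((completedValuation v).map_add x y) _) ?_
          rcases max_cases (completedValuation v x) (completedValuation v y) with
            ⟨h, _⟩ | ⟨h, _⟩ <;> rw [h] <;> assumption
        neg_mem' := by
          intro x hx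
          simpa [Valuation.map_neg] using hx }
    exact ⟨⟨G, (isClopen_completedValuation_lt v ha).isOpen⟩, hU⟩

theorem isBoundedSet_integer_completedField (v : Valuation R Γ₀) :
    IsBoundedSet ((completedValuation v).integer : Set (CompletedField v)) := fun U hU => by
  obtain ⟨⟨a, b⟩, hab, hU⟩ := (hasBasis_nhds_zero_completedField v).mem_iff.1 hU
  refine ⟨_, (hasBasis_nhds_zero_completedField v).mem_of_mem hab, fun x hx y hy => hU ?_⟩
  refine lt_of_le_of_lt ?_ hx
  rw [map_mul]
  exact mul_le_mul_left (mul_le_of_le_one_right' hy) _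

theorem continuous_toCompletedField [TopologicalSpace R] [IsTopologicalRing R]
    {v : Valuation R Γ₀} {x : Spv R} (hx : IsContinuousVal x) (h : Represents v x) :
    Continuous (toCompletedField v) := by
  refine continuous_of_continuousAt_zero (toCompletedField v) ?_
  rw [ContinuousAt, map_zero, (hasBasis_nhds_zero_completedField v).tendsto_right_iff]
  rintro ⟨a, b⟩ ⟨ha, hb⟩
  have h0 : (0 : R) ∈ {c : R | v c * v a < v b} := by simpa [zero_lt_iff] using hb
  refine Filter.mem_of_superset ((hx.isOpen_lt h ha).mem_nhds h0) fun c hc => ?_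
  change completedValuation v (toCompletedField v c) * v a < v b
  rwa [completedValuation_toCompletedField]

/-- Continuous maps to the completed residue fields of equivalent valuations that induce the same
preorder on a dense set induce the same preorder. -/
theorem isEquiv_comap_completedValuation {Γ₁ : Type w} [LinearOrderedCommGroupWithZero Γ₁]
    {v : Valuation R Γ₀} {v' : Valuation R Γ₁} (hvv' : v.IsEquiv v') {E : Type z} [CommRing E]
    [TopologicalSpace E] {g : E →+* CompletedField v} {g' : E →+* CompletedField v'}
    (hg : Continuous g) (hg' : Continuous g') {S : Set E} (hS : Dense S)
    (h : ∀ c ∈ S, ∃ a b : R, v b ≠ 0 ∧ completedValuation v (g c) * v b = v a ∧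
      completedValuation v' (g' c) * v' b = v' a) :
    ((completedValuation v).comap g).IsEquiv ((completedValuation v').comap g') := by
  have hlt : ∀ a b, v a < v b ↔ v' a < v' b := fun a b => hvv'.lt_iff_lt
  have h0 : ∀ a, v a ≠ 0 ↔ v' a ≠ 0 := fun a => hvv'.eq_zero.ne
  have key : ∀ a b : R, v a ≠ 0 → ∀ y : E,
      completedValuation v (g y) * v a < v b ↔ completedValuation v' (g' y) * v' a < v' b := by
    intro a b ha y
    have hc := (isClopen_completedValuation_lt v (b := b) ha).preimage hg
    have hc' := (isClopen_completedValuation_lt v' (b := b) ((h0 a).1 ha)).preimage hg'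
    have hs : ∀ c ∈ S, completedValuation v (g c) * v a < v b ↔
        completedValuation v' (g' c) * v' a < v' b := by
      intro c hc
      obtain ⟨p, q, hq, h1, h2⟩ := h c hc
      rw [← mul_lt_mul_iff_left₀ (zero_lt_iff.2 hq),
        ← mul_lt_mul_iff_left₀ (zero_lt_iff.2 ((h0 q).1 hq)), mul_right_comm, h1, mul_right_comm, h2,
        ← map_mul, ← map_mul, ← map_mul, ← map_mul]
      exact hlt _ _
    -- The two conditions are clopen, so the set where they disagree is open. If nonempty, it would
    -- meet the dense set `S`.
    have hopen := ((hc.diff hc').union (hc'.diff hc)).isOpen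
    by_contra hne
    obtain ⟨c, hcS, hc1⟩ := hS.exists_mem_open hopen ⟨y, by
      change (_ < _ ∧ ¬ _ < _) ∨ (_ < _ ∧ ¬ _ < _)
      tauto⟩
    have := hs c hcS
    change (_ < _ ∧ ¬ _ < _) ∨ (_ < _ ∧ ¬ _ < _) at hc1
    tauto
  intro y z
  change completedValuation v (g y) ≤ completedValuation v (g z) ↔
    completedValuation v' (g' y) ≤ completedValuation v' (g' z)
  rw [← not_lt, ← not_lt, not_iff_not]
  constructor
  · intro hyz
    -- The threshold `v a / v b` equals the value at `y`. It separates `z`, which lies below, from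
    -- `y`, which does not, and `key` transports the separation.
    obtain ⟨a, b, hb, hab⟩ := exists_completedValuation_mul_eq v (g y)
    have h1 := (key b a hb z).1 (by rw [← hab]; gcongr; exact zero_lt_iff.2 hb)
    have h2 := mt (key b a hb y).2 (by rw [hab]; exact lt_irrefl _)
    exact lt_of_mul_lt_mul_right (h1.trans_le (not_lt.1 h2)) zero_le
  · intro hyz
    obtain ⟨a, b, hb, hab⟩ := exists_completedValuation_mul_eq v' (g' y)
    have hb' := (h0 b).2 hb
    have h1 := (key b a hb' z).2 (by rw [← hab]; gcongr; exact zero_lt_iff.2 hb)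
    have h2 := mt (key b a hb' y).1 (by rw [hab]; exact lt_irrefl _)
    exact lt_of_mul_lt_mul_right (h1.trans_le (not_lt.1 h2)) zero_le

/-- A valuation equivalent to the restriction of a valuation `w` of a field `L` along `h` extends
to `L`, provided that all values of `w` are quotients of values of the restriction. -/
theorem exists_eq_comap_of_isEquiv {S : Type u} [CommRing S] {L : Type w} [Field L]
    {Δ₀ : Type z} [LinearOrderedCommGroupWithZero Δ₀] (h : S →+* L) (w : Valuation L Γ₀)
    (hw : ∀ y : L, ∃ a b : S, w (h b) ≠ 0 ∧ w y * w (h b) = w (h a)) (r : Valuation S Δ₀)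
    (hr : r.IsEquiv (w.comap h)) :
    ∃ r' : Valuation L Δ₀, r'.IsEquiv w ∧ r = r'.comap h := by
  choose n d hd hnd using hw
  have hle : ∀ a b, r a ≤ r b ↔ w (h a) ≤ w (h b) := fun a b => hr a b
  have h0 : ∀ a, r a ≠ 0 ↔ w (h a) ≠ 0 := fun a => hr.eq_zero.ne
  have heq : ∀ {a b}, w (h a) = w (h b) → r a = r b := fun hab =>
    le_antisymm ((hle _ _).2 hab.le) ((hle _ _).2 hab.ge)
  let f : L → Δ₀ := fun y => r (n y) / r (d y)
  have hd' : ∀ y, r (d y) ≠ 0 := fun y => (h0 _).2 (hd y)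
  -- Independence of the chosen quotient: cross products with equal `w`-values have equal
  -- `r`-values.
  have hf : ∀ {y a b}, w (h b) ≠ 0 → w y * w (h b) = w (h a) → f y = r a / r b := by
    intro y a b hb hab
    have hb' := (h0 b).2 hb
    rw [div_eq_div_iff (hd' y) hb', ← map_mul, ← map_mul]
    refine heq ?_
    rw [map_mul, map_mul, map_mul, map_mul, ← hnd, ← hab]
    exact mul_right_comm _ _ _
  have hfh : ∀ a, f (h a) = r a := fun a => by
    rw [hf (a := a) (b := 1) (by simp) (by simp)]
    simp
  have hfle : ∀ y z, f y ≤ f z ↔ w y ≤ w z := by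
    intro y z
    rw [div_le_div_iff₀ (zero_lt_iff.2 (hd' y)) (zero_lt_iff.2 (hd' z)), ← map_mul, ← map_mul, hle,
      map_mul, map_mul, map_mul, map_mul, ← hnd, ← hnd, mul_right_comm, mul_assoc, mul_assoc,
      mul_le_mul_iff_left₀]
    exact mul_pos (zero_lt_iff.2 (hd z)) (zero_lt_iff.2 (hd y))
  let r' : Valuation L Δ₀ :=
    { toFun := f
      map_zero' := by rw [← map_zero h, hfh, map_zero]
      map_one' := by rw [← map_one h, hfh, map_one]
      map_mul' := fun y z => by
        rw [hf (y := y * z) (a := n y * n z) (b := d y * d z), map_mul, map_mul, mul_div_mul_comm]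
        · rw [map_mul, map_mul]
          exact mul_ne_zero (hd y) (hd z)
        · rw [map_mul, map_mul, map_mul, map_mul, map_mul, ← hnd, ← hnd]
          ac_rfl
      map_add_le_max' := fun y z => by
        rw [le_max_iff, hfle, hfle, ← le_max_iff]
        exact w.map_add y z }
  exact ⟨r', fun y z => hfle y z, Valuation.ext fun a => (hfh a).symm⟩

end CompletedField

/-! ### The valuation on the stalk. -/

section Stalk

variable {A : Type u} [CommRing A] [TopologicalSpace A] {Aplus : Subring A}
  {Γ₀ : Type v} [LinearOrderedCommGroupWithZero Γ₀]

/-- The canonical map `A → K̂_v` extends to `A⟨T/s⟩` if `v` lies in `R(T/s)`. -/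
theorem existsUnique_valueToCompletedField [IsTopologicalRing A] {D : RationalDatum A}
    {x : Spa Aplus} (hx : x ∈ rationalOpen Aplus D) {v : Valuation A Γ₀} (hv : Represents v x.1) :
    ∃! g : RatCompl D →+* CompletedField v,
      Continuous g ∧ g.comp (toRatCompl D) = toCompletedField v := by
  have hs : v D.s ≠ 0 := fun h => hx.1 ((hv.eq_zero_iff _).2 h)
  have hs' : toCompletedField v D.s ≠ 0 := fun h => hs (by
    rw [← completedValuation_toCompletedField, h, map_zero])
  refine existsUnique_ratCompl_lift D (toCompletedField v) (Units.mk0 _ hs')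
    (continuous_toCompletedField x.2.1 hv) rfl
    (isPowerBoundedSet_of_subset_subring (isBoundedSet_integer_completedField v) ?_)
  rintro _ ⟨t, ht, rfl⟩
  change completedValuation v (toCompletedField v t * (toCompletedField v D.s)⁻¹) ≤ 1
  rw [map_mul, map_inv₀, completedValuation_toCompletedField, completedValuation_toCompletedField,
    ← div_eq_mul_inv, div_le_one₀ (zero_lt_iff.2 hs)]
  exact (hv _ _).1 (hx.2 t ht)

/-- The continuous extension `A⟨T/s⟩ → K̂_v` of the canonical map `A → K̂_v`. -/
def valueToCompletedField [IsTopologicalRing A] {D : RationalDatum A}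
    {x : Spa Aplus} (hx : x ∈ rationalOpen Aplus D) {v : Valuation A Γ₀} (hv : Represents v x.1) :
    RatCompl D →+* CompletedField v :=
  (existsUnique_valueToCompletedField hx hv).exists.choose

theorem valueToCompletedField_spec [IsTopologicalRing A] {D : RationalDatum A}
    {x : Spa Aplus} (hx : x ∈ rationalOpen Aplus D) {v : Valuation A Γ₀} (hv : Represents v x.1) :
    Continuous (valueToCompletedField hx hv) ∧
      (valueToCompletedField hx hv).comp (toRatCompl D) = toCompletedField v :=
  (existsUnique_valueToCompletedField hx hv).exists.choose_spec

theorem valueToCompletedField_comp [IsTopologicalRing A] {D D' : RationalDatum A}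
    {x : Spa Aplus} (hx : x ∈ rationalOpen Aplus D) (hx' : x ∈ rationalOpen Aplus D')
    {v : Valuation A Γ₀} (hv : Represents v x.1) {ρ : RatCompl D →+* RatCompl D'}
    (hρ : IsCanonicalMap ρ) :
    (valueToCompletedField hx' hv).comp ρ = valueToCompletedField hx hv := by
  have h := valueToCompletedField_spec hx hv
  have h' := valueToCompletedField_spec hx' hv
  exact ratCompl_ringHom_ext D (h'.1.comp hρ.1) h.1 (by rw [RingHom.comp_assoc, hρ.2, h'.2, h.2])

/-- Evaluation of sections at a rational subset. -/
def evalAt {U : Opens (Spa Aplus)} (D : {D : RationalDatum A // rationalOpen Aplus D ≤ U}) :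
    sections Aplus U →+* RatCompl D.1 :=
  (Pi.evalRingHom _ D).comp (sections Aplus U).subtype

theorem continuous_evalAt {U : Opens (Spa Aplus)}
    (D : {D : RationalDatum A // rationalOpen Aplus D ≤ U}) : Continuous (evalAt D) := by
  have h : Continuous fun f : ∀ E : {E : RationalDatum A // rationalOpen Aplus E ≤ U},
    RatCompl E.1 => f D := continuous_apply _
  exact h.comp continuous_subtype_val

variable (hA : IsHuberPair Aplus)

include hA

/-- The value of a section at a point of a rational subset does not depend on the subset. -/
theorem valueToCompletedField_evalAt_eq [IsTopologicalRing A] {U : Opens (Spa Aplus)}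
    (D D' : {D : RationalDatum A // rationalOpen Aplus D ≤ U}) {x : Spa Aplus}
    (hx : x ∈ rationalOpen Aplus D.1) (hx' : x ∈ rationalOpen Aplus D'.1)
    {v : Valuation A Γ₀} (hv : Represents v x.1) (f : sections Aplus U) :
    valueToCompletedField hx hv (evalAt D f) = valueToCompletedField hx' hv (evalAt D' f) := by
  -- Both values are computed on a rational neighbourhood of `x` inside the intersection.
  obtain ⟨E, hxE, hE⟩ := exists_rationalOpen_le hA.isHuberRing
    (U := rationalOpen Aplus D.1 ⊓ rationalOpen Aplus D'.1) ⟨hx, hx'⟩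
  have key : ∀ (D : {D : RationalDatum A // rationalOpen Aplus D ≤ U})
      (hD : x ∈ rationalOpen Aplus D.1) (hED : rationalOpen Aplus E ≤ rationalOpen Aplus D.1),
      valueToCompletedField hD hv (evalAt D f) =
        valueToCompletedField hxE hv (evalAt ⟨E, hED.trans D.2⟩ f) := by
    intro D hD hED
    rw [← valueToCompletedField_comp hD hxE hv (isCanonicalMap_canonicalMap hA hED)]
    exact congrArg (valueToCompletedField hxE hv)
      (sections_apply_eq hA f (D := D) (D' := ⟨E, hED.trans D.2⟩) hED).symm
  rw [key D hx (hE.trans inf_le_left), key D' hx' (hE.trans inf_le_right)]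

/-- The map `𝒪(U) → K̂_v` at a point of `U`. -/
def sectionsToCompletedField [IsTopologicalRing A] {U : Opens (Spa Aplus)} {x : Spa Aplus}
    (hx : x ∈ U) {v : Valuation A Γ₀} (hv : Represents v x.1) :
    sections Aplus U →+* CompletedField v :=
  (valueToCompletedField (exists_rationalOpen_le hA.isHuberRing hx).choose_spec.1 hv).comp
    (evalAt ⟨_, (exists_rationalOpen_le hA.isHuberRing hx).choose_spec.2⟩)

theorem sectionsToCompletedField_apply [IsTopologicalRing A] {U : Opens (Spa Aplus)}
    {x : Spa Aplus} (hx : x ∈ U) {v : Valuation A Γ₀} (hv : Represents v x.1)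
    (D : {D : RationalDatum A // rationalOpen Aplus D ≤ U}) (hxD : x ∈ rationalOpen Aplus D.1)
    (f : sections Aplus U) :
    sectionsToCompletedField hA hx hv f = valueToCompletedField hxD hv (evalAt D f) := by
  rw [sectionsToCompletedField, RingHom.comp_apply]
  exact valueToCompletedField_evalAt_eq hA ⟨_, _⟩ D _ hxD hv f

theorem continuous_sectionsToCompletedField [IsTopologicalRing A] {U : Opens (Spa Aplus)}
    {x : Spa Aplus} (hx : x ∈ U) {v : Valuation A Γ₀} (hv : Represents v x.1) :
    Continuous (sectionsToCompletedField hA hx hv) :=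
  (valueToCompletedField_spec _ hv).1.comp (continuous_evalAt _)

theorem sectionsToCompletedField_comp_toSections [IsTopologicalRing A] {U : Opens (Spa Aplus)}
    {x : Spa Aplus} (hx : x ∈ U) {v : Valuation A Γ₀} (hv : Represents v x.1) :
    (sectionsToCompletedField hA hx hv).comp (toSections Aplus U) = toCompletedField v :=
  (valueToCompletedField_spec (exists_rationalOpen_le hA.isHuberRing hx).choose_spec.1 hv).2

theorem sectionsToCompletedField_comp_restrict [IsTopologicalRing A] {U V : Opens (Spa Aplus)}
    (hVU : V ≤ U) {x : Spa Aplus} (hx : x ∈ V) {v : Valuation A Γ₀} (hv : Represents v x.1) :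
    (sectionsToCompletedField hA hx hv).comp (restrict Aplus hVU) =
      sectionsToCompletedField hA (hVU hx) hv := by
  obtain ⟨D, hxD, hD⟩ := exists_rationalOpen_le hA.isHuberRing hx
  ext f
  rw [RingHom.comp_apply, sectionsToCompletedField_apply hA hx hv ⟨D, hD⟩ hxD,
    sectionsToCompletedField_apply hA (hVU hx) hv ⟨D, hD.trans hVU⟩ hxD]
  rfl

/-- The map `𝒪_x → K̂_v`. -/
def stalkToCompletedField [IsTopologicalRing A] (x : Spa Aplus) {v : Valuation A Γ₀}
    (hv : Represents v x.1) : Stalk Aplus x →+* CompletedField v :=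
  (Limits.colimit.desc
    ((OpenNhds.inclusion (X := TopCat.of (Spa Aplus)) x).op ⋙ ringPresheaf Aplus)
    { pt := CommRingCat.of (CompletedField v)
      ι :=
        { app := fun W => CommRingCat.ofHom (sectionsToCompletedField hA W.unop.2 hv)
          naturality := fun _ V i => CommRingCat.hom_ext
            (sectionsToCompletedField_comp_restrict hA (leOfHom i.unop) V.unop.2 hv) } }).hom

theorem stalkToCompletedField_comp_germ [IsTopologicalRing A] {x : Spa Aplus}
    {U : Opens (Spa Aplus)} (hx : x ∈ U) {v : Valuation A Γ₀} (hv : Represents v x.1) :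
    (stalkToCompletedField hA x hv).comp (germ Aplus U x hx) =
      sectionsToCompletedField hA hx hv :=
  congrArg CommRingCat.Hom.hom (Limits.colimit.ι_desc (F := (OpenNhds.inclusion
    (X := TopCat.of (Spa Aplus)) x).op ⋙ ringPresheaf Aplus) _ (op ⟨U, hx⟩))

theorem stalkToCompletedField_germ [IsTopologicalRing A] {x : Spa Aplus}
    {U : Opens (Spa Aplus)} (hx : x ∈ U) {v : Valuation A Γ₀} (hv : Represents v x.1)
    (f : sections Aplus U) :
    stalkToCompletedField hA x hv (germ Aplus U x hx f) = sectionsToCompletedField hA hx hv f :=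
  DFunLike.congr_fun (stalkToCompletedField_comp_germ hA hx hv) f

/-- Two elements of the stalk come from a common rational subset. -/
theorem exists_germ_eq_pair (x : Spa Aplus) (a b : Stalk Aplus x) :
    ∃ (D : RationalDatum A) (hx : x ∈ rationalOpen Aplus D)
      (f g : sections Aplus (rationalOpen Aplus D)),
      germ Aplus _ x hx f = a ∧ germ Aplus _ x hx g = b := by
  obtain ⟨U, hxU, s, rfl⟩ := TopCat.Presheaf.exists_germ_eq (X := TopCat.of (Spa Aplus))
    (ringPresheaf Aplus) a
  obtain ⟨V, hxV, t, rfl⟩ := TopCat.Presheaf.exists_germ_eq (X := TopCat.of (Spa Aplus))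
    (ringPresheaf Aplus) b
  obtain ⟨D, hxD, hD⟩ := exists_rationalOpen_le hA.isHuberRing (U := U ⊓ V) ⟨hxU, hxV⟩
  exact ⟨D, hxD, restrict Aplus (hD.trans inf_le_left) s, restrict Aplus (hD.trans inf_le_right) t,
    TopCat.Presheaf.germ_res_apply (X := TopCat.of (Spa Aplus)) (ringPresheaf Aplus)
      (homOfLE (hD.trans inf_le_left)) x hxD s,
    TopCat.Presheaf.germ_res_apply (X := TopCat.of (Spa Aplus)) (ringPresheaf Aplus)
      (homOfLE (hD.trans inf_le_right)) x hxD t⟩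

omit hA in
theorem completedValuation_mul_eq {D : RationalDatum A} {v : Valuation A Γ₀}
    {g : RatCompl D →+* CompletedField v} (hg : g.comp (toRatCompl D) = toCompletedField v)
    {y : RatCompl D} {a b : A} (h : y * toRatCompl D b = toRatCompl D a) :
    completedValuation v (g y) * v b = v a := by
  have hg' : ∀ a, g (toRatCompl D a) = toCompletedField v a := fun a => DFunLike.congr_fun hg a
  rw [← completedValuation_toCompletedField v a, ← hg', ← h, map_mul, map_mul, hg',
    completedValuation_toCompletedField]

-- The dense subring is the image of `A[1/s]`. There both values are determined by `A`: an element
-- is a numerator over a power of `s`, and `v s ≠ 0` on the rational subset.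
omit hA in
theorem isEquiv_comap_valueToCompletedField [IsTopologicalRing A] {D : RationalDatum A}
    {x : Spa Aplus} (hx : x ∈ rationalOpen Aplus D) {v : Valuation A Γ₀} (hv : Represents v x.1)
    {Γ₁ : Type w} [LinearOrderedCommGroupWithZero Γ₁] {v' : Valuation A Γ₁}
    (hv' : Represents v' x.1) :
    ((completedValuation v).comap (valueToCompletedField hx hv)).IsEquiv
      ((completedValuation v').comap (valueToCompletedField hx hv')) := by
  obtain ⟨hg, hgA⟩ := valueToCompletedField_spec hx hv
  obtain ⟨hg', hgA'⟩ := valueToCompletedField_spec hx hv'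
  let ι : RatLoc D →+* RatCompl D := UniformSpace.Completion.coeRingHom
  have hι : DenseRange ι := UniformSpace.Completion.denseRange_coe
  have hto : ∀ a, toRatCompl D a = ι (algebraMap A (RatLoc D) a) := fun _ => rfl
  refine isEquiv_comap_completedValuation (hv.isEquiv hv') hg hg' hι ?_
  rintro _ ⟨c, rfl⟩
  obtain ⟨n, a, ha⟩ := IsLocalization.Away.surj D.s c
  have hs : v D.s ≠ 0 := fun h => hx.1 ((hv.eq_zero_iff _).2 h)
  have hc : ι c * toRatCompl D (D.s ^ n) = toRatCompl D a := by
    rw [hto, hto, ← map_mul, map_pow, ha]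
  exact ⟨a, D.s ^ n, by rw [map_pow]; exact pow_ne_zero n hs,
    completedValuation_mul_eq hgA hc, completedValuation_mul_eq hgA' hc⟩

theorem isEquiv_comap_stalkToCompletedField [IsTopologicalRing A] {x : Spa Aplus}
    {v : Valuation A Γ₀} (hv : Represents v x.1)
    {Γ₁ : Type w} [LinearOrderedCommGroupWithZero Γ₁] {v' : Valuation A Γ₁}
    (hv' : Represents v' x.1) :
    ((completedValuation v).comap (stalkToCompletedField hA x hv)).IsEquiv
      ((completedValuation v').comap (stalkToCompletedField hA x hv')) := by
  intro a b
  obtain ⟨D, hx, f, g, rfl, rfl⟩ := exists_germ_eq_pair hA x a b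
  simp only [Valuation.comap_apply, stalkToCompletedField_germ,
    sectionsToCompletedField_apply hA hx _ ⟨D, le_rfl⟩ hx]
  exact isEquiv_comap_valueToCompletedField hx hv hv' _ _

/-- Numerators and denominators can be taken from `A`, mapped to the stalk as global sections. This
is the hypothesis of `exists_eq_comap_of_isEquiv`. -/
theorem exists_mul_completedValuation_stalk [IsTopologicalRing A] {x : Spa Aplus}
    {v : Valuation A Γ₀} (hv : Represents v x.1) (y : CompletedField v) :
    ∃ a b : Stalk Aplus x, completedValuation v (stalkToCompletedField hA x hv b) ≠ 0 ∧
      completedValuation v y * completedValuation v (stalkToCompletedField hA x hv b) =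
        completedValuation v (stalkToCompletedField hA x hv a) := by
  have hx : x ∈ (⊤ : Opens (Spa Aplus)) := Opens.mem_top x
  have h : ∀ a : A, completedValuation v (stalkToCompletedField hA x hv
      (germ Aplus ⊤ x hx (toSections Aplus ⊤ a))) = v a := fun a => by
    rw [stalkToCompletedField_germ, ← RingHom.comp_apply, sectionsToCompletedField_comp_toSections,
      completedValuation_toCompletedField]
  obtain ⟨a, b, hb, hab⟩ := exists_completedValuation_mul_eq v y
  exact ⟨germ Aplus ⊤ x hx (toSections Aplus ⊤ a), germ Aplus ⊤ x hx (toSections Aplus ⊤ b),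
    by rwa [h b], by rw [h b, h a, hab]⟩

end Stalk

end AdicSpectrum

end

theorem mainTheorem1 {A : Type u} [CommRing A] [TopologicalSpace A] (Aplus : Subring A)
    (hA : AdicSpectrum.IsHuberPair Aplus) :
    -- (1) the rational subsets form a basis of the topology
    IsTopologicalBasis (Set.range (AdicSpectrum.rationalSubset Aplus)) ∧
    -- (2) `A(T/s)` and its universal property
    (∀ D : AdicSpectrum.RationalDatum A,
      NonarchimedeanRing (AdicSpectrum.RatLoc D) ∧
      Continuous (algebraMap A (AdicSpectrum.RatLoc D)) ∧
      IsUnit (algebraMap A (AdicSpectrum.RatLoc D) D.s) ∧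
      AdicSpectrum.IsPowerBoundedSet (AdicSpectrum.RatLoc.fractions D) ∧
      ∀ (B : Type v) [CommRing B] [TopologicalSpace B] [NonarchimedeanRing B]
        (f : A →+* B) (b : Bˣ), Continuous f → (b : B) = f D.s →
        AdicSpectrum.IsPowerBoundedSet ((fun t : A => f t * ((b⁻¹ : Bˣ) : B)) '' (D.T : Set A)) →
        ∃! g : AdicSpectrum.RatLoc D →+* B,
          Continuous g ∧ g.comp (algebraMap A (AdicSpectrum.RatLoc D)) = f) ∧
    -- (3) the presheaf has complete separated values, and its values on rational subsets
    (∀ U : Opens (AdicSpectrum.Spa Aplus),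
      T2Space ((AdicSpectrum.structurePresheaf Aplus).obj (op U)) ∧
      AdicSpectrum.IsCompleteRing ((AdicSpectrum.structurePresheaf Aplus).obj (op U))) ∧
    (∀ D : AdicSpectrum.RationalDatum A,
      Function.Bijective (AdicSpectrum.toValue Aplus D) ∧
      IsHomeomorph (AdicSpectrum.toValue Aplus D)) ∧
    (∀ (D D' : AdicSpectrum.RationalDatum A)
      (h : AdicSpectrum.rationalOpen Aplus D' ≤ AdicSpectrum.rationalOpen Aplus D),
      ∃! ρ : AdicSpectrum.RatCompl D →+* AdicSpectrum.RatCompl D',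
        AdicSpectrum.IsCanonicalMap ρ ∧
        ∀ f : AdicSpectrum.sections Aplus (AdicSpectrum.rationalOpen Aplus D),
          AdicSpectrum.toValue Aplus D' (AdicSpectrum.restrict Aplus h f) =
            ρ (AdicSpectrum.toValue Aplus D f)) ∧
    -- (4) the valuations on the stalks
    (∀ x : AdicSpectrum.Spa Aplus, ∃ vx : AdicSpectrum.Spv (AdicSpectrum.Stalk Aplus x),
      ∀ (Γ₀ : Type w) [LinearOrderedCommGroupWithZero Γ₀] (v : Valuation A Γ₀),
        AdicSpectrum.Represents v x.1 →
        ∃ h : AdicSpectrum.Stalk Aplus x →+* AdicSpectrum.CompletedField v,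
          (∀ (U : Opens (AdicSpectrum.Spa Aplus)) (hx : x ∈ U),
            Continuous (h.comp (AdicSpectrum.germ Aplus U x hx)) ∧
            (h.comp (AdicSpectrum.germ Aplus U x hx)).comp (AdicSpectrum.toSections Aplus U) =
              AdicSpectrum.toCompletedField v) ∧
          AdicSpectrum.Represents ((AdicSpectrum.completedValuation v).comap h) vx ∧
          ∀ (Δ₀ : Type z) [LinearOrderedCommGroupWithZero Δ₀]
            (r : Valuation (AdicSpectrum.Stalk Aplus x) Δ₀), AdicSpectrum.Represents r vx →
            ∃ r' : Valuation (AdicSpectrum.CompletedField v) Δ₀,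
              r'.IsEquiv (AdicSpectrum.completedValuation v) ∧ r = r'.comap h) := by
  have hH := hA.isHuberRing
  have := hH.1
  refine ⟨AdicSpectrum.isTopologicalBasis_rationalSubset Aplus hH, fun D => ?_, fun U => ?_,
    fun D => ?_, fun D D' h => ?_, fun x => ?_⟩
  · refine ⟨inferInstance, AdicSpectrum.RatLoc.continuous_algebraMap D,
      AdicSpectrum.RatLoc.isUnit_algebraMap_s D, AdicSpectrum.RatLoc.isPowerBoundedSet_fractions D,
      fun B _ _ _ f b hf hb hpb => AdicSpectrum.RatLoc.existsUnique_lift D f b hf hb hpb⟩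
  · exact ⟨inferInstanceAs (T2Space (AdicSpectrum.sections Aplus U)),
      AdicSpectrum.isCompleteRing_sections U⟩
  · have h := AdicSpectrum.isHomeomorph_toValue hA D
    exact ⟨h.bijective, h⟩
  · obtain ⟨ρ, hρ, huniq⟩ := AdicSpectrum.existsUnique_isCanonicalMap hA h
    refine ⟨ρ, ⟨hρ, fun f => ?_⟩, fun ρ' hρ' => huniq ρ' hρ'.1⟩
    exact (f.2 ⟨D, le_rfl⟩ ⟨D', h⟩ h ρ hρ).symm
  -- The class must be fixed before `v` is given, so it is built from the canonical representative
  -- of `x`; other representatives are compared with it.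
  · refine ⟨AdicSpectrum.valClass ((AdicSpectrum.completedValuation _).comap
      (AdicSpectrum.stalkToCompletedField hA x (AdicSpectrum.represents_valuation x.1))),
      fun Γ₀ _ v hv => ⟨AdicSpectrum.stalkToCompletedField hA x hv, fun U hx => ?_, ?_,
        fun Δ₀ _ r hr => ?_⟩⟩
    · rw [AdicSpectrum.stalkToCompletedField_comp_germ hA hx hv]
      exact ⟨AdicSpectrum.continuous_sectionsToCompletedField hA hx hv,
        AdicSpectrum.sectionsToCompletedField_comp_toSections hA hx hv⟩
    · exact AdicSpectrum.isEquiv_comap_stalkToCompletedField hA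
        (AdicSpectrum.represents_valuation x.1) hv
    · refine AdicSpectrum.exists_eq_comap_of_isEquiv _ _
        (AdicSpectrum.exists_mul_completedValuation_stalk hA hv) r ?_
      exact (hr.isEquiv (AdicSpectrum.represents_valClass _)).trans
        (AdicSpectrum.isEquiv_comap_stalkToCompletedField hA
          (AdicSpectrum.represents_valuation x.1) hv)
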